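/- Let $k$ be a field, $N$ a lattice (a finitely generated free abelian group) and $M=\operatorname{Hom}(N,\mathbb Z)$. A fan is given by its collection of monoids: a finite non-empty collection $\Delta$ of finitely generated saturated submonoids $S\subseteq M$ with $\mathbb ZS=M$, closed under localization $S\rightsquigarrow S+\mathbb N(-u)$ ($u\in S$), such that the sum of any two members of $\Delta$ is a localization of each. Let $X=X_\Delta$ be the (normal) toric variety glued from the charts $\operatorname{Spec}k[S]$, $S\in\Delta$, where $\operatorname{Spec}k[S]$ and $\operatorname{Spec}k[T]$ are glued along $\operatorname{Spec}k[S+T]$. The torus-invariant prime divisors of $X$ are the points of codimension one that are given on some chart by an $S$-graded prime ideal of $k[S]$. Let $G$ be the group of torus-invariant Weil divisors on $X$ modulo the subgroup of torus-invariant Cartier (that is, locally principal) divisors. For $X=\operatorname{Spec}k[S]$ this group is denoted $\mathrm{Cl}(S)$. For $S\in\Delta$ the point corresponding to $S$ in the orbit space is the generic point of the closed orbit of $\operatorname{Spec}k[S]$, i.e. the prime ideal spanned by the $t^s$ with $s\in S$ not invertible in $S$. (1) Let $D$ be a torus-invariant Weil divisor on $X$ whose class in $G$ has finite order. Then this order is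 the least common multiple, over all $S\in\Delta$ such that the point corresponding to $S$ lies on (the support of) $D$, of the orders in $\mathrm{Cl}(S)$ of the class of the restriction $D|_{\operatorname{Spec}k[S]}$. If $D$ is a prime divisor and the point corresponding to $S$ lies on $D$, then $D|_{\operatorname{Spec}k[S]}$ is the $S$-graded height one prime $\mathfrak p$ of $k[S]$ corresponding to $D$; so for prime $D$ the order of $D$ in $G$ is the least common multiple of the orders of the primes $\mathfrak p$ corresponding to $D$ in these groups $\mathrm{Cl}(S)$. (2) Let $\sigma\subset N_{\mathbb R}$ be a simplicial (strongly convex rational polyhedral) cone, $S_\sigma=\sigma^\vee\cap M$ and $X_\sigma=\operatorname{Spec}k[S_\sigma]$. Then the group $G$ of $X_\sigma$, i.e. $\mathrm{Cl}(S_\sigma)$, is finite, and its order is the multiplicity of $\sigma$, i.e. the index in $N\cap\mathbb R\sigma$ of the subgroup generated by the primitive lattice generators of the edges of $\sigma$. -/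

import Mathlib

open CategoryTheory CategoryTheory.Limits AlgebraicGeometry TopologicalSpace
open scoped TensorProduct

universe u v

namespace Toric

/-! ### Monoid algebras of submonoids of a lattice -/

section Monoids

variable {M : Type v} [AddCommGroup M]

/-- The localization `S + ℕ(-u)` of a submonoid `S ⊆ M` at an element `u`. -/
def localization (S : AddSubmonoid M) (u : M) : AddSubmonoid M :=
  S ⊔ AddSubmonoid.multiples (-u)

theorem mem_localization {S : AddSubmonoid M} {u m : M} :
    m ∈ localization S u ↔ ∃ n : ℕ, m + n • u ∈ S := by
  constructor
  · intro h
    obtain ⟨s, hs, t, ht, rfl⟩ := AddSubmonoid.mem_sup.1 h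
    obtain ⟨n, rfl⟩ := (AddSubmonoid.mem_multiples_iff _ _).1 ht
    exact ⟨n, by simpa using hs⟩
  · rintro ⟨n, hn⟩
    refine AddSubmonoid.mem_sup.2 ⟨_, hn, n • (-u), ?_, by simp⟩
    exact (AddSubmonoid.mem_multiples_iff _ _).2 ⟨n, rfl⟩

/-- A submonoid `S ⊆ M` with `ℤS = M` is saturated if `n u ∈ S` with `n > 0` implies `u ∈ S`. -/
def IsSaturated (S : AddSubmonoid M) : Prop :=
  ∀ (n : ℕ) (u : M), 0 < n → n • u ∈ S → u ∈ S

theorem twoUniqueSums_of_free [Module.Free ℤ M] : TwoUniqueSums M :=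
  TwoUniqueSums.of_injective_addHom
    (Module.Free.chooseBasis ℤ M).repr.toAddEquiv.toAddMonoidHom.toAddHom
    (Module.Free.chooseBasis ℤ M).repr.injective inferInstance

instance twoUniqueSums_submonoid [Module.Free ℤ M] (S : AddSubmonoid M) : TwoUniqueSums S :=
  TwoUniqueSums.of_injective_addHom S.subtype.toAddHom Subtype.val_injective twoUniqueSums_of_free

variable (k : Type u) [Field k]

instance isDomain_monoidAlgebra [Module.Free ℤ M] (S : AddSubmonoid M) :
    IsDomain (AddMonoidAlgebra k S) := inferInstance

instance isNoetherianRing_monoidAlgebra (S : AddSubmonoid M) [AddMonoid.FG S] :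
    IsNoetherianRing (AddMonoidAlgebra k S) :=
  Algebra.FiniteType.isNoetherianRing k _

/-- The monoid algebra `k[S]` as an object of `CommRingCat`. -/
noncomputable abbrev coordRing (S : AddSubmonoid M) : CommRingCat.{max u v} :=
  CommRingCat.of (AddMonoidAlgebra k S)

/-- The inclusion `k[S] ⊆ k[T]` for `S ⊆ T`. -/
noncomputable def coordMap {S T : AddSubmonoid M} (h : S ≤ T) :
    AddMonoidAlgebra k S →+* AddMonoidAlgebra k T :=
  AddMonoidAlgebra.mapDomainRingHom k (AddSubmonoid.inclusion h)

theorem coordMap_injective {S T : AddSubmonoid M} (h : S ≤ T) :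
    Function.Injective (coordMap k h) :=
  AddMonoidAlgebra.mapDomain_injective (AddSubmonoid.inclusion_injective h)

theorem coordMap_single {S T : AddSubmonoid M} (h : S ≤ T) (s : S) (a : k) :
    coordMap k h (AddMonoidAlgebra.single s a) =
      AddMonoidAlgebra.single (AddSubmonoid.inclusion h s) a :=
  AddMonoidAlgebra.mapDomain_single

theorem isLocalization_away {S T : AddSubmonoid M} (h : S ≤ T) (u : S)
    (hT : T = localization S u) :
    letI := (coordMap k h).toAlgebra
    IsLocalization.Away (AddMonoidAlgebra.single u 1 : AddMonoidAlgebra k S)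
      (AddMonoidAlgebra k T) := by
  let := (coordMap k h).toAlgebra
  have hu : (-(u : M)) ∈ T := by
    rw [hT, mem_localization]; exact ⟨1, by simp⟩
  have key : ∀ n : ℕ, coordMap k h (AddMonoidAlgebra.single u 1 ^ n) *
      AddMonoidAlgebra.single (⟨_, hu⟩ : T) 1 ^ n = 1 := by
    intro n
    rw [map_pow, ← mul_pow, coordMap_single, AddMonoidAlgebra.single_mul_single]
    have : AddSubmonoid.inclusion h u + ⟨_, hu⟩ = (0 : T) := by ext; simp
    rw [this, mul_one, ← AddMonoidAlgebra.one_def, one_pow]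
  refine ⟨?_, ?_, ?_⟩
  · rintro ⟨_, n, rfl⟩
    exact IsUnit.of_mul_eq_one _ (key n)
  · intro z
    suffices ∃ (n : ℕ) (x : AddMonoidAlgebra k S),
        z * coordMap k h (AddMonoidAlgebra.single u 1 ^ n) = coordMap k h x by
      obtain ⟨n, x, hx⟩ := this
      exact ⟨⟨x, ⟨_, n, rfl⟩⟩, hx⟩
    induction z using AddMonoidAlgebra.induction_linear with
    | zero => exact ⟨0, 0, by simp⟩
    | add a b ha hb =>
      obtain ⟨n, x, hx⟩ := ha
      obtain ⟨m, y, hy⟩ := hb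
      refine ⟨n + m, x * AddMonoidAlgebra.single u 1 ^ m + y * AddMonoidAlgebra.single u 1 ^ n, ?_⟩
      rw [map_add, map_mul, map_mul, ← hx, ← hy, pow_add, map_mul]
      ring
    | single t a =>
      obtain ⟨t, ht⟩ := t
      obtain ⟨n, hn⟩ := mem_localization.1 (hT ▸ ht)
      refine ⟨n, AddMonoidAlgebra.single ⟨_, hn⟩ a, ?_⟩
      rw [AddMonoidAlgebra.single_pow, coordMap_single, coordMap_single,
        AddMonoidAlgebra.single_mul_single]
      congr 1
      simp
  · intro x y hxy
    exact ⟨1, by rw [coordMap_injective k h hxy]⟩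

theorem isOpenImmersion_coordMap {S T : AddSubmonoid M} (h : S ≤ T) (u : S)
    (hT : T = localization S u) :
    IsOpenImmersion (Spec.map (CommRingCat.ofHom (coordMap k h))) := by
  let := (coordMap k h).toAlgebra
  have := isLocalization_away k h u hT
  exact IsOpenImmersion.of_isLocalization
    (AddMonoidAlgebra.single u 1 : AddMonoidAlgebra k S) (S := AddMonoidAlgebra k T)

end Monoids

/-! ### The toric variety of a fan, described by its monoids -/

/-- A fan, described by its collection of monoids `S_σ`: a finite non-empty collection of finitely
generated saturated submonoids of `M` that generate `M` as a group, closed under localization, and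
such that the sum of any two of them is a localization of each. -/
structure MonoidFan (M : Type v) [AddCommGroup M] where
  charts : Finset (AddSubmonoid M)
  nonempty : charts.Nonempty
  fg : ∀ S ∈ charts, S.FG
  saturated : ∀ S ∈ charts, IsSaturated S
  closure_eq_top : ∀ S ∈ charts, AddSubgroup.closure (S : Set M) = ⊤
  localization_mem : ∀ S ∈ charts, ∀ u ∈ S, localization S u ∈ charts
  sup_eq_localization : ∀ S ∈ charts, ∀ T ∈ charts, ∃ u ∈ S, S ⊔ T = localization S u

namespace MonoidFan

section Gluing

variable {M : Type v} [AddCommGroup M] (Δ : MonoidFan M) (k : Type u) [Field k]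

/-- The monoids of the fan, ordered by inclusion. -/
abbrev Chart : Type v := {S : AddSubmonoid M // S ∈ Δ.charts}

instance fg_chart (S : Δ.Chart) : AddMonoid.FG S.1 :=
  (AddMonoid.fg_iff_addSubmonoid_fg S.1).2 (Δ.fg S.1 S.2)

/-- The sum `S + T` of two monoids of the fan. -/
def sup (S T : Δ.Chart) : Δ.Chart :=
  ⟨S.1 ⊔ T.1, by
    obtain ⟨u, hu, h⟩ := Δ.sup_eq_localization S.1 S.2 T.1 T.2
    rw [h]
    exact Δ.localization_mem S.1 S.2 u hu⟩

/-- The diagram `S ↦ k[S]` of coordinate rings and inclusions. -/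
noncomputable def ringDiagram : Δ.Chart ⥤ CommRingCat.{max u v} where
  obj S := coordRing k S.1
  map f := CommRingCat.ofHom (coordMap k (leOfHom f))
  map_id S := by
    ext1
    refine AddMonoidAlgebra.ringHom_ext (fun a => ?_) (fun s => ?_) <;>
    exact coordMap_single k _ _ _
  map_comp f g := by
    ext1
    refine AddMonoidAlgebra.ringHom_ext (fun a => ?_) (fun s => ?_)
    all_goals
      change coordMap k _ _ = coordMap k _ (coordMap k _ _)
      rw [coordMap_single, coordMap_single, coordMap_single]
      rfl

/-- The diagram `S ↦ Spec k[S]` of affine charts, in which `Spec k[T] ⟶ Spec k[S]` for `S ⊆ T`. -/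
noncomputable def chartDiagram : (Δ.Chart)ᵒᵖ ⥤ Scheme.{max u v} :=
  (Δ.ringDiagram k).op ⋙ Scheme.Spec

theorem exists_eq_localization {S T : Δ.Chart} (h : S ≤ T) :
    ∃ u : S.1, T.1 = localization S.1 u := by
  obtain ⟨u, hu, h'⟩ := Δ.sup_eq_localization S.1 S.2 T.1 T.2
  exact ⟨⟨u, hu⟩, by rw [← h', sup_eq_right.2 h]⟩

instance isOpenImmersion_chartDiagram {i j : (Δ.Chart)ᵒᵖ} (f : i ⟶ j) :
    IsOpenImmersion ((Δ.chartDiagram k).map f) := by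
  obtain ⟨u, hu⟩ := Δ.exists_eq_localization (leOfHom f.unop)
  exact isOpenImmersion_coordMap k (leOfHom f.unop) u hu

theorem sup_localization {S T₁ T₂ : AddSubmonoid M} (h : S ≤ T₁) (u : M)
    (hT : T₂ = localization S u) : T₁ ⊔ T₂ = localization T₁ u := by
  rw [hT, localization, localization, ← sup_assoc, sup_eq_left.2 h]

instance isLocallyDirected_chartDiagram :
    (Δ.chartDiagram k ⋙ Scheme.forget).IsLocallyDirected := by
  refine ⟨fun {i j l} fi fj xi xj hx => ?_⟩
  have hli : l.unop ≤ i.unop := leOfHom fi.unop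
  have hlj : l.unop ≤ j.unop := leOfHom fj.unop
  obtain ⟨u, hu⟩ := Δ.exists_eq_localization hlj
  have hsup : (Δ.sup i.unop j.unop).1 = localization i.unop.1 (u : M) :=
    sup_localization hli (u : M) hu
  have hile : i.unop ≤ Δ.sup i.unop j.unop := le_sup_left (a := i.unop.1)
  have hjle : j.unop ≤ Δ.sup i.unop j.unop := le_sup_right (a := i.unop.1)
  let p : PrimeSpectrum (AddMonoidAlgebra k i.unop.1) := xi
  let q : PrimeSpectrum (AddMonoidAlgebra k j.unop.1) := xj
  have hpq : PrimeSpectrum.comap (coordMap k hli) p = PrimeSpectrum.comap (coordMap k hlj) q := hx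
  let t : AddMonoidAlgebra k l.unop.1 := AddMonoidAlgebra.single u 1
  have hunit : IsUnit (coordMap k hlj t) := by
    let := (coordMap k hlj).toAlgebra
    have := isLocalization_away k hlj u hu
    exact IsLocalization.Away.algebraMap_isUnit (S := AddMonoidAlgebra k j.unop.1) t
  have htp : coordMap k hli t ∉ p.asIdeal := fun h => by
    have h1 : t ∈ (PrimeSpectrum.comap (coordMap k hli) p).asIdeal := h
    rw [hpq] at h1
    exact q.2.ne_top (Ideal.eq_top_of_isUnit_mem _ h1 hunit)
  have hp : p ∈ Set.range (PrimeSpectrum.comap (coordMap k hile)) := by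
    let := (coordMap k hile).toAlgebra
    have := isLocalization_away k hile (AddSubmonoid.inclusion hli u) hsup
    have h2 := PrimeSpectrum.localization_away_comap_range
      (AddMonoidAlgebra k (Δ.sup i.unop j.unop).1)
      (AddMonoidAlgebra.single (AddSubmonoid.inclusion hli u) 1 : AddMonoidAlgebra k i.unop.1)
    have h3 : p ∈ Set.range (PrimeSpectrum.comap (algebraMap (AddMonoidAlgebra k i.unop.1)
        (AddMonoidAlgebra k (Δ.sup i.unop j.unop).1))) := by
      rw [h2]
      rw [coordMap_single] at htp
      exact htp
    exact h3
  obtain ⟨x, hxp⟩ := hp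
  let fli : Opposite.op (Δ.sup i.unop j.unop) ⟶ i := (homOfLE hile).op
  let flj : Opposite.op (Δ.sup i.unop j.unop) ⟶ j := (homOfLE hjle).op
  refine ⟨_, fli, flj, x, hxp, ?_⟩
  apply ((Δ.chartDiagram k).map fj).isOpenEmbedding.injective
  let x' : (Δ.chartDiagram k).obj (Opposite.op (Δ.sup i.unop j.unop)) := x
  have e : flj ≫ fj = fli ≫ fi := Subsingleton.elim _ _
  have h4 : (Δ.chartDiagram k).map fj ((Δ.chartDiagram k).map flj x') =
      (Δ.chartDiagram k).map fi ((Δ.chartDiagram k).map fli x') := by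
    rw [← Scheme.Hom.comp_apply, ← Scheme.Hom.comp_apply, ← Functor.map_comp, ← Functor.map_comp, e]
  have h6 : (Δ.chartDiagram k).map fli x' = xi := hxp
  rw [h6] at h4
  exact h4.trans hx

/-- The toric variety `X_Δ`: the gluing of the affine charts `Spec k[S]`, `S ∈ Δ`, where
`Spec k[S]` and `Spec k[T]` are glued along `Spec k[S + T]`. -/
noncomputable def toricVariety : Scheme.{max u v} := colimit (Δ.chartDiagram k)

/-- The open immersion of the affine chart `Spec k[S]` into `X_Δ`. -/
noncomputable def chartι (S : Δ.Chart) : Spec (coordRing k S.1) ⟶ Δ.toricVariety k :=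
  colimit.ι (Δ.chartDiagram k) (Opposite.op S)

instance isOpenImmersion_chartι (S : Δ.Chart) : IsOpenImmersion (Δ.chartι k S) :=
  inferInstanceAs (IsOpenImmersion (colimit.ι (Δ.chartDiagram k) (Opposite.op S)))

theorem exists_chartι_eq (x : Δ.toricVariety k) :
    ∃ (S : Δ.Chart) (y : Spec (coordRing k S.1)), Δ.chartι k S y = x := by
  obtain ⟨S, y, h⟩ := Scheme.IsLocallyDirected.ι_jointly_surjective (Δ.chartDiagram k) x
  exact ⟨S.unop, y, h⟩

theorem chartι_map {S T : Δ.Chart} (h : S ≤ T) :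
    Spec.map (CommRingCat.ofHom (coordMap k h)) ≫ Δ.chartι k S = Δ.chartι k T :=
  colimit.w (Δ.chartDiagram k) (homOfLE h).op

/-- The cover of `X_Δ` by its affine charts. -/
noncomputable def chartCover : (Δ.toricVariety k).OpenCover :=
  Scheme.IsLocallyDirected.openCover (Δ.chartDiagram k)

instance isLocallyNoetherian_toricVariety : IsLocallyNoetherian (Δ.toricVariety k) := by
  rw [isLocallyNoetherian_iff_openCover (Δ.chartCover k)]
  intro i
  exact inferInstanceAs (IsLocallyNoetherian (Spec (coordRing k i.unop.1)))

instance isIntegral_toricVariety [Module.Free ℤ M] : IsIntegral (Δ.toricVariety k) := by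
  have hint : ∀ i, IsIntegral ((Δ.chartCover k).X i) := fun i =>
    inferInstanceAs (IsIntegral (Spec (coordRing k i.unop.1)))
  have hred : IsReduced (Δ.toricVariety k) := IsReduced.of_openCover (𝒰 := Δ.chartCover k)
  have hne : Nonempty (Δ.toricVariety k) := by
    obtain ⟨S, hS⟩ := Δ.nonempty
    exact (inferInstance : Nonempty (Spec (coordRing k S))).map (Δ.chartι k ⟨S, hS⟩)
  have hpre : PreirreducibleSpace (Δ.toricVariety k) := by
    refine PreirreducibleSpace.of_isOpenCover ?_ (Δ.chartCover k).isOpenCover_opensRange ?_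
    · intro i j _ hdis
      let y : Spec (coordRing k (Δ.sup i.unop j.unop).1) := Classical.arbitrary _
      have hi : i.unop ≤ Δ.sup i.unop j.unop := le_sup_left (a := i.unop.1)
      have hj : j.unop ≤ Δ.sup i.unop j.unop := le_sup_right (a := i.unop.1)
      have h1 : Δ.chartι k (Δ.sup i.unop j.unop) y ∈ ((Δ.chartCover k).f i).opensRange :=
        ⟨Spec.map (CommRingCat.ofHom (coordMap k hi)) y, by
          rw [← Δ.chartι_map k hi]; rfl⟩
      have h2 : Δ.chartι k (Δ.sup i.unop j.unop) y ∈ ((Δ.chartCover k).f j).opensRange :=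
        ⟨Spec.map (CommRingCat.ofHom (coordMap k hj)) y, by
          rw [← Δ.chartι_map k hj]; rfl⟩
      exact (disjoint_iff_inf_le.1 hdis) ⟨h1, h2⟩
    · intro i
      have := hint i
      have h : IsPreirreducible (Set.range ((Δ.chartCover k).f i)) := by
        rw [← Set.image_univ]
        exact (PreirreducibleSpace.isPreirreducible_univ).image _
          ((Δ.chartCover k).f i).continuous.continuousOn
      exact Subtype.preirreducibleSpace h
  have : IrreducibleSpace (Δ.toricVariety k) := { toNonempty := hne }
  exact isIntegral_of_irreducibleSpace_of_isReduced _

end Gluing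

end MonoidFan

/-! ### Divisors supported on a given set of points -/

section Divisors

variable (X : Scheme.{u}) (I : Set X)

/-- The prime divisors of `X` (given by their generic points, the points of codimension one)
that belong to `I`. -/
abbrev PrimeDivisor : Type u := {x : X // Order.coheight x = 1 ∧ x ∈ I}

/-- The Weil divisors of `X` supported on the prime divisors in `I`. -/
abbrev WeilDivisor : Type u := PrimeDivisor X I →₀ ℤ

variable {X I}

open Classical in
/-- The coefficient of a Weil divisor at an arbitrary point, `0` off the primes in `I`. -/
noncomputable def WeilDivisor.coeff (D : WeilDivisor X I) (x : X) : ℤ :=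
  if h : Order.coheight x = 1 ∧ x ∈ I then D ⟨x, h⟩ else 0

/-- The support of a Weil divisor: the union of the closures of the primes occurring in it. -/
def WeilDivisor.supp (D : WeilDivisor X I) : Set X :=
  {x | ∃ y : PrimeDivisor X I, D y ≠ 0 ∧ x ∈ closure {y.1}}

@[simp] theorem WeilDivisor.coeff_zero (x : X) : (0 : WeilDivisor X I).coeff x = 0 := by
  simp [WeilDivisor.coeff]

@[simp] theorem WeilDivisor.coeff_add (D E : WeilDivisor X I) (x : X) :
    (D + E).coeff x = D.coeff x + E.coeff x := by
  unfold WeilDivisor.coeff; split_ifs <;> simp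

@[simp] theorem WeilDivisor.coeff_neg (D : WeilDivisor X I) (x : X) :
    (-D).coeff x = -D.coeff x := by
  unfold WeilDivisor.coeff; split_ifs <;> simp

variable [IsIntegral X] [IsLocallyNoetherian X]

/-- `D` agrees on the open set `U` with the divisor of a rational function. -/
def WeilDivisor.IsPrincipalOn (D : WeilDivisor X I) (U : X.Opens) : Prop :=
  ∃ f : X.functionField, f ≠ 0 ∧
    ∀ x ∈ U, Order.coheight x = 1 → D.coeff x = Scheme.ord f x

theorem WeilDivisor.IsPrincipalOn.mono {D : WeilDivisor X I} {U V : X.Opens}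
    (h : D.IsPrincipalOn V) (hUV : U ≤ V) : D.IsPrincipalOn U := by
  obtain ⟨f, hf, h⟩ := h
  exact ⟨f, hf, fun x hx => h x (hUV hx)⟩

theorem WeilDivisor.IsPrincipalOn.zero (U : X.Opens) :
    (0 : WeilDivisor X I).IsPrincipalOn U := by
  refine ⟨1, one_ne_zero, fun x _ _ => ?_⟩
  have h := Scheme.ord_mul (x := x) (one_ne_zero (α := X.functionField)) one_ne_zero
  rw [mul_one] at h
  rw [WeilDivisor.coeff_zero]
  omega

theorem WeilDivisor.IsPrincipalOn.add {D E : WeilDivisor X I} {U : X.Opens}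
    (hD : D.IsPrincipalOn U) (hE : E.IsPrincipalOn U) : (D + E).IsPrincipalOn U := by
  obtain ⟨f, hf, hD⟩ := hD
  obtain ⟨g, hg, hE⟩ := hE
  refine ⟨f * g, mul_ne_zero hf hg, fun x hx h => ?_⟩
  rw [WeilDivisor.coeff_add, hD x hx h, hE x hx h, Scheme.ord_mul hf hg]

theorem WeilDivisor.IsPrincipalOn.neg {D : WeilDivisor X I} {U : X.Opens}
    (hD : D.IsPrincipalOn U) : (-D).IsPrincipalOn U := by
  obtain ⟨f, hf, hD⟩ := hD
  refine ⟨f⁻¹, inv_ne_zero hf, fun x hx h => ?_⟩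
  have h1 := Scheme.ord_mul (x := x) hf (inv_ne_zero hf)
  have h2 := Scheme.ord_mul (x := x) (one_ne_zero (α := X.functionField)) one_ne_zero
  rw [mul_inv_cancel₀ hf] at h1
  rw [mul_one] at h2
  rw [WeilDivisor.coeff_neg, hD x hx h]
  omega

variable (X I)

/-- The Cartier divisors among the Weil divisors supported on `I`: those that are locally the
divisor of a rational function. -/
def cartierDivisors : AddSubgroup (WeilDivisor X I) where
  carrier := {D | ∀ x : X, ∃ U : X.Opens, x ∈ U ∧ D.IsPrincipalOn U}
  zero_mem' x := ⟨⊤, trivial, WeilDivisor.IsPrincipalOn.zero ⊤⟩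
  add_mem' {D E} hD hE x := by
    obtain ⟨U, hU, hDU⟩ := hD x
    obtain ⟨V, hV, hEV⟩ := hE x
    exact ⟨U ⊓ V, ⟨hU, hV⟩, (hDU.mono inf_le_left).add (hEV.mono inf_le_right)⟩
  neg_mem' {D} hD x := by
    obtain ⟨U, hU, hDU⟩ := hD x
    exact ⟨U, hU, hDU.neg⟩

/-- The cokernel of the inclusion of the Cartier divisors into the Weil divisors, all supported
on `I`. -/
abbrev WeilModCartier : Type u := WeilDivisor X I ⧸ cartierDivisors X I

end Divisors

/-! ### Torus-invariant divisors on the affine charts and on `X_Δ` -/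

section Affine

variable {M : Type v} [AddCommGroup M] (k : Type u) [Field k]

open Classical in
/-- The torus-invariant points of `Spec k[S]`: the prime ideals that are homogeneous for the
grading of `k[S]` by `S`. -/
def invariantPoints (S : AddSubmonoid M) : Set (Spec (coordRing k S)) :=
  {p | (PrimeSpectrum.asIdeal p).IsHomogeneous
    (AddMonoidAlgebra.grade k : S → Submodule k (AddMonoidAlgebra k S))}

open Classical in
/-- The ring homomorphism `k[S] → k[M]` with `t^s ↦ t^s` if `s` is invertible in `S`, and
`t^s ↦ 0` otherwise. -/
noncomputable def orbitHom (S : AddSubmonoid M) :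
    AddMonoidAlgebra k S →ₐ[k] AddMonoidAlgebra k M :=
  AddMonoidAlgebra.lift k (AddMonoidAlgebra k M) S
    { toFun := fun s => if -(s.toAdd : M) ∈ S then AddMonoidAlgebra.single (s.toAdd : M) 1 else 0
      map_one' := by
        simp [AddMonoidAlgebra.one_def]
      map_mul' := fun s t => by
        have hst : -((s.toAdd : M) + t.toAdd) ∈ S ↔ -(s.toAdd : M) ∈ S ∧ -(t.toAdd : M) ∈ S := by
          constructor
          · intro h
            have h1 := S.add_mem h s.toAdd.2
            have h2 := S.add_mem h t.toAdd.2
            refine ⟨?_, ?_⟩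
            · rwa [neg_add_rev, add_comm (-(t.toAdd : M)), add_assoc, neg_add_cancel,
                add_zero] at h2
            · rwa [neg_add_rev, add_assoc, neg_add_cancel, add_zero] at h1
          · rintro ⟨h1, h2⟩
            rw [neg_add]
            exact S.add_mem h1 h2
        simp only [toAdd_mul, AddSubmonoid.coe_add, hst]
        by_cases hs : -(s.toAdd : M) ∈ S <;> by_cases ht : -(t.toAdd : M) ∈ S <;>
          simp [hs, ht, AddMonoidAlgebra.single_mul_single] }

/-- The point of the orbit space corresponding to `S`: the generic point of the closed orbit of
`Spec k[S]`, that is, the prime ideal spanned by the `t^s` with `s ∈ S` not invertible. -/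
noncomputable def orbitPoint [Module.Free ℤ M] (S : AddSubmonoid M) : Spec (coordRing k S) :=
  have : TwoUniqueSums M := twoUniqueSums_of_free
  (⟨RingHom.ker (orbitHom k S), RingHom.ker_isPrime (orbitHom k S)⟩ :
    PrimeSpectrum (AddMonoidAlgebra k S))

variable (S : AddSubmonoid M)

/-- The torus-invariant prime divisors of `Spec k[S]`: the homogeneous primes of height one. -/
abbrev AffinePrimeDivisor : Type (max u v) := PrimeDivisor _ (invariantPoints k S)

/-- The torus-invariant Weil divisors of `Spec k[S]`. -/
abbrev AffineWeilDivisor : Type (max u v) := WeilDivisor _ (invariantPoints k S)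

/-- The group `Cl(S)`: torus-invariant Weil divisors of `Spec k[S]` modulo torus-invariant
Cartier divisors. -/
abbrev LocalClassGroup [Module.Free ℤ M] [AddMonoid.FG S] : Type (max u v) :=
  WeilModCartier _ (invariantPoints k S)

end Affine

namespace MonoidFan

variable {M : Type v} [AddCommGroup M] (Δ : MonoidFan M) (k : Type u) [Field k]

/-- The torus-invariant points of `X_Δ`. -/
def invariantPoints : Set (Δ.toricVariety k) :=
  {x | ∃ (S : Δ.Chart), ∃ p ∈ Toric.invariantPoints k S.1, Δ.chartι k S p = x}

/-- The torus-invariant prime divisors `D_i` of `X_Δ`. -/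
abbrev ToricPrimeDivisor : Type (max u v) := PrimeDivisor _ (Δ.invariantPoints k)

/-- The group `⨁ ℤ D_i` of torus-invariant Weil divisors of `X_Δ`. -/
abbrev ToricWeilDivisor : Type (max u v) := WeilDivisor _ (Δ.invariantPoints k)

variable {k}

/-- A homogeneous height one prime of `k[S]`, considered as a prime divisor of `X_Δ`. -/
noncomputable def ofChart (S : Δ.Chart) (p : AffinePrimeDivisor k S.1) : Δ.ToricPrimeDivisor k :=
  ⟨Δ.chartι k S p.1, by
    exact ⟨(coheight_eq_of_isOpenImmersion (Δ.chartι k S)).trans p.2.1, S, p.1, p.2.2, rfl⟩⟩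

theorem ofChart_injective (S : Δ.Chart) :
    Function.Injective (Δ.ofChart S : AffinePrimeDivisor k S.1 → _) := fun _ _ h =>
  Subtype.ext ((Δ.chartι k S).isOpenEmbedding.injective (congrArg Subtype.val h))

/-- The restriction of torus-invariant Weil divisors from `X_Δ` to `Spec k[S]`: the coefficient
of the restriction of `D` at `p` is the coefficient of `D` at the prime divisor given by `p`. -/
noncomputable def restrict (S : Δ.Chart) : Δ.ToricWeilDivisor k →+ AffineWeilDivisor k S.1 :=
  Finsupp.comapDomain.addMonoidHom (Δ.ofChart_injective S)

variable [Module.Free ℤ M]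

variable (k) in
/-- The group `G`: torus-invariant Weil divisors of `X_Δ` modulo torus-invariant Cartier
divisors. -/
abbrev G : Type (max u v) := WeilModCartier _ (Δ.invariantPoints k)

/-- The class in `G` of a torus-invariant Weil divisor. -/
noncomputable def toG (D : Δ.ToricWeilDivisor k) : Δ.G k := QuotientAddGroup.mk D

/-- The class in `Cl(S)` of the restriction of a torus-invariant Weil divisor to `Spec k[S]`. -/
noncomputable def toCl (S : Δ.Chart) (D : Δ.ToricWeilDivisor k) : LocalClassGroup k S.1 :=
  QuotientAddGroup.mk (Δ.restrict S D)

open Classical in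
/-- The monoids `S` of the fan such that the point of the orbit space corresponding to `S` lies
on `D`. -/
noncomputable def chartsOn (D : Δ.ToricWeilDivisor k) : Finset Δ.Chart :=
  Δ.charts.attach.filter fun S => Δ.chartι k S (orbitPoint k S.1) ∈ D.supp

end MonoidFan

/-! ### Cones in `N_ℝ` -/

section Cones

variable (N : Type v) [AddCommGroup N]

/-- A strongly convex rational polyhedral cone in `N_ℝ = ℝ ⊗ N`. -/
structure RationalCone where
  cone : PointedCone ℝ (ℝ ⊗[ℤ] N)
  rational : ∃ V : Finset N, cone = PointedCone.hull ℝ ((fun v : N => (1 : ℝ) ⊗ₜ[ℤ] v) '' V)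
  salient : (cone : ConvexCone ℝ (ℝ ⊗[ℤ] N)).Salient

variable {N}

/-- The real linear form `⟨u, ·⟩` on `N_ℝ` given by `u ∈ M = Hom(N, ℤ)`. -/
noncomputable def pairing (u : Module.Dual ℤ N) : ℝ ⊗[ℤ] N →ₗ[ℝ] ℝ :=
  LinearMap.liftBaseChange ℝ ((Algebra.linearMap ℤ ℝ).comp u)

theorem pairing_add (u w : Module.Dual ℤ N) : pairing (u + w) = pairing u + pairing w := by
  refine TensorProduct.AlgebraTensorModule.ext fun a v => ?_
  simp [pairing, mul_add]

theorem pairing_tmul (u : Module.Dual ℤ N) (a : ℝ) (v : N) :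
    pairing u (a ⊗ₜ[ℤ] v) = a * (u v : ℝ) := by
  simp [pairing]

namespace RationalCone

variable (σ : RationalCone N)

/-- The monoid `S_σ = σ^∨ ∩ M`. -/
noncomputable def dualMonoid : AddSubmonoid (Module.Dual ℤ N) where
  carrier := {u | ∀ x ∈ σ.cone, 0 ≤ pairing u x}
  zero_mem' x _ := by simp [pairing]
  add_mem' {u w} hu hw x hx := by
    rw [pairing_add]
    exact add_nonneg (hu x hx) (hw x hx)

theorem mem_dualMonoid_iff {V : Finset N}
    (hV : σ.cone = PointedCone.hull ℝ ((fun v : N => (1 : ℝ) ⊗ₜ[ℤ] v) '' V))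
    (u : Module.Dual ℤ N) : u ∈ σ.dualMonoid ↔ ∀ v ∈ V, 0 ≤ u v := by
  constructor
  · intro h v hv
    have h1 := h (1 ⊗ₜ v) (by rw [hV]; exact Submodule.subset_span ⟨v, hv, rfl⟩)
    rw [pairing_tmul, one_mul] at h1
    exact_mod_cast h1
  · intro h x hx
    rw [hV] at hx
    induction hx using Submodule.span_induction with
    | mem x hx =>
      obtain ⟨v, hv, rfl⟩ := hx
      have h1 := h v hv
      change 0 ≤ pairing u ((1 : ℝ) ⊗ₜ[ℤ] v)
      rw [pairing_tmul, one_mul]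
      exact_mod_cast h1
    | zero => simp
    | add x y _ _ hx hy => rw [map_add]; exact add_nonneg hx hy
    | smul a x _ hx =>
      have h1 : pairing u (a • x) = (a : ℝ) * pairing u x := by
        rw [← smul_eq_mul, ← map_smul]; rfl
      rw [h1]
      exact mul_nonneg a.2 hx

/-- Gordan's lemma. -/
instance fg_dualMonoid [Module.Free ℤ N] [Module.Finite ℤ N] : AddMonoid.FG σ.dualMonoid := by
  obtain ⟨V, hV⟩ := σ.rational
  have hfg : AddMonoid.FG (Module.Dual ℤ N) :=
    AddGroup.fg_iff_addMonoid_fg.1 (Module.Finite.iff_addGroup_fg.1 inferInstance)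
  obtain ⟨n, φ, hφ⟩ := AddSubmonoid.fg_iff_exists_fin_addMonoidHom.1 hfg.fg_top
  let f : ((Fin n → ℕ) × (V → ℕ)) →+ (V → ℤ) :=
    { toFun := fun a v => φ a.1 v
      map_zero' := by ext; simp
      map_add' := fun a b => by ext; simp }
  let g : ((Fin n → ℕ) × (V → ℕ)) →+ (V → ℤ) :=
    { toFun := fun a v => a.2 v
      map_zero' := by ext; simp
      map_add' := fun a b => by ext; simp }
  have h := AddSubmonoid.fg_eqLocusM f g
  rw [AddMonoid.fg_iff_addSubmonoid_fg]
  have h2 : σ.dualMonoid = (f.eqLocusM g).map (φ.comp (AddMonoidHom.fst _ _)) := by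
    ext u
    rw [σ.mem_dualMonoid_iff hV, AddSubmonoid.mem_map]
    constructor
    · intro hu
      obtain ⟨a, rfl⟩ : ∃ a, φ a = u := by
        have : u ∈ AddMonoidHom.mrange φ := by rw [hφ]; trivial
        exact this
      refine ⟨(a, fun v => (φ a v).toNat), ?_, rfl⟩
      change f _ = g _
      ext v
      exact (Int.toNat_of_nonneg (hu v v.2)).symm
    · rintro ⟨⟨a, c⟩, hac, rfl⟩ v hv
      have h3 : φ a v = (c ⟨v, hv⟩ : ℤ) := congrFun (show f _ = g _ from hac) ⟨v, hv⟩
      change 0 ≤ φ a v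
      rw [h3]
      positivity
  rw [h2]
  exact h.map _

/-- The primitive generators of the edges of `σ`: the elements `v ∈ N`, not a proper multiple of
another element of `N`, such that `ℝ≥0 v` is a face of `σ`. -/
def primitiveGenerators : Set N :=
  {v | (∀ (n : ℕ) (w : N), n • w = v → n = 1) ∧
    (PointedCone.hull ℝ {(1 : ℝ) ⊗ₜ[ℤ] v}).IsFaceOf σ.cone}

/-- The lattice `N_σ = N ∩ ℝσ`. -/
def spanLattice : AddSubgroup N where
  carrier := {v | (1 : ℝ) ⊗ₜ[ℤ] v ∈ Submodule.span ℝ (σ.cone : Set (ℝ ⊗[ℤ] N))}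
  zero_mem' := by simp
  add_mem' {v w} hv hw := by
    rw [Set.mem_ofPred_eq, TensorProduct.tmul_add]
    exact add_mem hv hw
  neg_mem' {v} hv := by
    rw [Set.mem_ofPred_eq, TensorProduct.tmul_neg]
    exact neg_mem hv

/-- The multiplicity of `σ`: the index in `N_σ` of the subgroup generated by the primitive
generators of the edges of `σ`. -/
noncomputable def multiplicity : ℕ :=
  (AddSubgroup.closure σ.primitiveGenerators).relIndex σ.spanLattice

end RationalCone

end Cones

end Toric

namespace Toric

/-! ### Orders of vanishing and open immersions -/

/-! Part (1) holds because being Cartier is local. An open immersion changes neither codimension nor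
order of vanishing, so `n • D` is Cartier on `X_Δ` iff its restriction to every chart is
(`toG_eq_zero_iff`). A homogeneous prime of `k[S]` contains no unit `t^s`, so it lies inside the
prime of the closed orbit. If that orbit point is not on `D`, then `D` restricts to zero on the
chart (`toCl_eq_zero_of_notMem`). Hence `n` kills the class of `D` iff it kills the local classes on
the charts whose point lies on `D`, and the order is the least common multiple of the local orders.

For part (2), let `w i` be the primitive edge generators of `σ`. The invariant prime divisors of
`Spec k[S_σ]` correspond to the edges (`edgeDivisor_bijective`). Each becomes principal after
localizing to the half-space `u (w i) ≥ 0`, so the order of `g` at edge `i` is the minimum of `u (w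
i)` over the exponents `u` of `g` (`ord_edgePoint`). Invariant Weil divisors thus form `ℤ^ι`, and
the claim is that the Cartier ones are exactly the vectors `(u (w i))_i` with `u ∈ M`.

One inclusion comes from the divisor of `t^u` (`mem_cartierDivisors_of_coeff_eq`). For the other
(`exists_coeff_eq_of_mem_cartierDivisors`), let `D` be the divisor of `f` near the orbit point, and
write `f = a / b` in lowest terms in the factorial ring `k[M]`. A prime factor of `a` or `b` cannot
define a hypersurface through the orbit point, since `D` has no component there. So it divides, in
`k[M]`, some `r ∈ k[S]` outside the orbit prime, and comparing exponents shows that its orders at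
all edges are those of a single character (`isMonomialAtEdges_of_mul`). Multiplying over the factors
gives the same for `f`.

The class group is therefore the cokernel of `M → ℤ^ι`. Its order is the absolute value of a
determinant, whose transpose computes the index of the `w i` in `N ∩ ℝσ` (`index_range_evalAt`,
`index_range_evalAt_eq_multiplicity`). -/

theorem ord_ringEquiv {R S : Type*} [CommRing R] [CommRing S] (e : R ≃+* S) (x : R) :
    Ring.ord S (e x) = Ring.ord R x := by
  rw [Ring.ord, Ring.ord, Module.length_quotient, Module.length_quotient,
    ← Order.coheight_orderIso e.idealComapOrderIso.symm, RingEquiv.idealComapOrderIso_symm_apply,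
    Ideal.map_span, Set.image_singleton]

theorem ordFrac_ringEquiv {R S K L : Type*} [CommRing R] [IsDomain R] [IsNoetherianRing R]
    [Ring.KrullDimLE 1 R] [CommRing S] [IsDomain S] [IsNoetherianRing S]
    [Ring.KrullDimLE 1 S]
    [Field K] [Algebra R K] [IsFractionRing R K] [Field L] [Algebra S L] [IsFractionRing S L]
    (e : R ≃+* S) (φ : K →+* L) (h : ∀ r, φ (algebraMap R K r) = algebraMap S L (e r)) (z : K) :
    Ring.ordFrac S (φ z) = Ring.ordFrac R z := by
  have key (r : R) : Ring.ordFrac S (algebraMap S L (e r)) = Ring.ordFrac R (algebraMap R K r) := by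
    by_cases hr : r = 0
    · simp [hr]
    have hr' : e r ≠ 0 := by simpa using hr
    rw [Ring.ordFrac_eq_ord S hr', Ring.ordFrac_eq_ord R hr,
      Ring.ordMonoidWithZeroHom_eq_ord (mem_nonZeroDivisors_of_ne_zero hr'),
      Ring.ordMonoidWithZeroHom_eq_ord (mem_nonZeroDivisors_of_ne_zero hr), ord_ringEquiv]
  obtain ⟨a, b, -, rfl⟩ := IsFractionRing.div_surjective (A := R) z
  simp [h, key]

section OpenImmersion

variable {X U : Scheme.{u}} [IsIntegral X] [IsIntegral U] (j : U ⟶ X) [IsOpenImmersion j]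

/-- The isomorphism between the function fields of an integral scheme and of an open subscheme. -/
noncomputable def functionFieldHom : X.functionField →+* U.functionField :=
  (X.presheaf.stalkSpecializes (specializes_of_eq (genericPoint_eq_of_isOpenImmersion j)) ≫
    j.stalkMap (genericPoint U)).hom

theorem functionFieldHom_bijective : Function.Bijective (functionFieldHom j) := by
  have : IsIso (X.presheaf.stalkSpecializes
      (specializes_of_eq (genericPoint_eq_of_isOpenImmersion j))) :=
    (X.presheaf.stalkCongr (.of_eq (genericPoint_eq_of_isOpenImmersion j).symm)).isIso_hom
  exact ConcreteCategory.bijective_of_isIso (X.presheaf.stalkSpecializes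
    (specializes_of_eq (genericPoint_eq_of_isOpenImmersion j)) ≫ j.stalkMap (genericPoint U))

theorem functionFieldHom_algebraMap (y : U) (r : X.presheaf.stalk (j y)) :
    functionFieldHom j (algebraMap _ _ r) = algebraMap _ U.functionField (j.stalkMap y r) := by
  change (X.presheaf.stalkSpecializes _ ≫
    X.presheaf.stalkSpecializes (specializes_of_eq (genericPoint_eq_of_isOpenImmersion j)) ≫
      j.stalkMap (genericPoint U)) r = (j.stalkMap y ≫ U.presheaf.stalkSpecializes _) r
  rw [← Category.assoc, TopCat.Presheaf.stalkSpecializes_comp,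
    ← Scheme.Hom.stalkSpecializes_stalkMap j _ _
      ((genericPoint_spec U).specializes (Set.mem_univ y))]

variable [IsLocallyNoetherian X] [IsLocallyNoetherian U]

/-- The order depends only on the local ring inside its fraction field, and an open immersion is an
isomorphism on stalks. -/
theorem ord_functionFieldHom (f : X.functionField) (y : U) :
    Scheme.ord (functionFieldHom j f) y = Scheme.ord f (j y) := by
  have hco : Order.coheight (j y) = Order.coheight y := coheight_eq_of_isOpenImmersion j
  by_cases hy : Order.coheight y = 1
  · have hjy := hco.trans hy
    rw [Scheme.ord_eq_ordHom_of_coheight_eq_one hy, Scheme.ord_eq_ordHom_of_coheight_eq_one hjy]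
    congr 2
    have : Ring.KrullDimLE 1 (X.presheaf.stalk (j y)) := krullDimLE_of_coheight_le hjy.le
    have : Ring.KrullDimLE 1 (U.presheaf.stalk y) := krullDimLE_of_coheight_le hy.le
    exact ordFrac_ringEquiv (asIso (j.stalkMap y)).commRingCatIsoToRingEquiv _
      (functionFieldHom_algebraMap j y) f
  · rw [Scheme.ord_eq_zero_of_coheight_neq_one hy,
      Scheme.ord_eq_zero_of_coheight_neq_one (hco ▸ hy)]

end OpenImmersion

/-! ### Orders of vanishing on an affine scheme -/

section Affine

variable {R : CommRingCat.{u}} [IsDomain R]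

theorem algebraMap_toStalk (x : Spec R) (g : R) :
    algebraMap ((Spec R).presheaf.stalk x) (Spec R).functionField (StructureSheaf.toStalk R x g) =
      algebraMap R _ g :=
  congrArg (fun φ => φ.hom g) (StructureSheaf.toStalk_stalkSpecializes (R := R)
    ((genericPoint_spec (Spec R)).specializes (Set.mem_univ x)))

theorem ord_eq_zero_of_notMem [IsNoetherianRing R] {g : R} (x : Spec R) (hg : g ∉ x.asIdeal) :
    Scheme.ord (algebraMap R (Spec R).functionField g) x = 0 := by
  by_cases hx : Order.coheight x = 1
  · have : Ring.KrullDimLE 1 ((Spec R).presheaf.stalk x) := krullDimLE_of_coheight_le hx.le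
    rw [← algebraMap_toStalk x, Scheme.ord_eq_ordHom_of_coheight_eq_one hx]
    have h : Scheme.ordHom x hx (algebraMap ((Spec R).presheaf.stalk x) (Spec R).functionField
        (StructureSheaf.toStalk R x g)) = 1 :=
      Ring.ordFrac_of_isUnit <| by
        let : Algebra R ((Spec R).presheaf.stalk x) := StructureSheaf.stalkAlgebra R x
        have hp : x.asIdeal.IsPrime := x.2
        have : IsLocalization.AtPrime ((Spec R).presheaf.stalk x) x.asIdeal :=
          StructureSheaf.IsLocalization.to_stalk R x
        exact IsLocalization.map_units ((Spec R).presheaf.stalk x)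
          (⟨g, hg⟩ : x.asIdeal.primeCompl)
    rw [h]
    rfl
  · exact Scheme.ord_eq_zero_of_coheight_neq_one hx _

/-- The local ring at `x` has maximal ideal `(ϖ)`, so its quotient by `ϖ` is the residue field, of
length one. -/
theorem ord_uniformizer [IsNoetherianRing R] {ϖ : R} (hϖ : Prime ϖ) (x : Spec R) (hx : x.asIdeal = Ideal.span {ϖ}) :
    Order.coheight x = 1 ∧ Scheme.ord (algebraMap R (Spec R).functionField ϖ) x = 1 := by
  have hco : Order.coheight x = 1 := by
    have h : x.asIdeal.height = 1 := by
      rw [hx]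
      exact Ideal.height_span_singleton_eq_one_of_mem_nonZeroDivisors
        (mem_nonZeroDivisors_of_ne_zero hϖ.ne_zero) hϖ.not_isUnit
    rw [← h]
    exact (idealHeight_eq_coheight R x).symm
  refine ⟨hco, ?_⟩
  have hp : x.asIdeal.IsPrime := x.2
  have : Ring.KrullDimLE 1 ((Spec R).presheaf.stalk x) := krullDimLE_of_coheight_le hco.le
  let : Algebra R ((Spec R).presheaf.stalk x) := StructureSheaf.stalkAlgebra R x
  have : IsLocalization.AtPrime ((Spec R).presheaf.stalk x) x.asIdeal :=
    StructureSheaf.IsLocalization.to_stalk R x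
  have hinj := IsLocalization.injective ((Spec R).presheaf.stalk x)
    x.asIdeal.primeCompl_le_nonZeroDivisors
  have hm : IsLocalRing.maximalIdeal ((Spec R).presheaf.stalk x) =
      Ideal.span {algebraMap R _ ϖ} := by
    rw [← IsLocalization.AtPrime.map_eq_maximalIdeal x.asIdeal, hx, Ideal.map_span,
      Set.image_singleton]
  have h0 : algebraMap R ((Spec R).presheaf.stalk x) ϖ ≠ 0 := by
    simpa using (map_ne_zero_iff _ hinj).2 hϖ.ne_zero
  have hord : Ring.ord ((Spec R).presheaf.stalk x) (algebraMap R _ ϖ) = 1 := by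
    rw [Ring.ord, ← hm, Module.length_eq_one_iff, isSimpleModule_iff_isCoatom]
    exact Ideal.isMaximal_def.1 inferInstance
  rw [← algebraMap_toStalk x, Scheme.ord_eq_iff hco]
  · refine (Ring.ordFrac_eq_ord _ h0).trans ?_
    rw [Ring.ordMonoidWithZeroHom_eq_coe _ (mem_nonZeroDivisors_of_ne_zero h0) (n := 1) hord]
    rfl
  · exact (map_ne_zero_iff _ (IsFractionRing.injective _ _)).2 h0

theorem functionFieldHom_spec {S : CommRingCat.{u}} [IsDomain S]
    (φ : R ⟶ S) [IsOpenImmersion (Spec.map φ)] (r : R) :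
    functionFieldHom (Spec.map φ) (algebraMap R _ r) = algebraMap S _ (φ r) := by
  have h1 := congrArg (fun φ => φ.hom r) (StructureSheaf.toStalk_stalkSpecializes (R := R)
    (specializes_of_eq (genericPoint_eq_of_isOpenImmersion (Spec.map φ))))
  have h2 := stalkMap_toStalk_apply φ (genericPoint (Spec S)) r
  refine Eq.trans ?_ h2
  exact congrArg ((Spec.map φ).stalkMap (genericPoint (Spec S))).hom h1

variable (R) in
/-- The embedding of a domain `R` into the function field of `Spec R`. -/
noncomputable def toFunctionField : R →+* (Spec R).functionField :=
  algebraMap R (Spec R).functionField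

theorem toFunctionField_injective : Function.Injective (toFunctionField R) :=
  IsFractionRing.injective R (Spec R).functionField

theorem exists_isRelPrime_fraction [UniqueFactorizationMonoid R] {f : (Spec R).functionField}
    (hf : f ≠ 0) : ∃ a b : R, a ≠ 0 ∧ b ≠ 0 ∧ IsRelPrime a b ∧
      f * toFunctionField R b = toFunctionField R a := by
  obtain ⟨a, b, hab, h⟩ := IsFractionRing.exists_reduced_fraction (A := R) f
  have h1 : f * toFunctionField R b = toFunctionField R a := by
    rw [← h]
    exact IsLocalization.mk'_spec _ _ _
  refine ⟨a, b, ?_, nonZeroDivisors.ne_zero b.2, hab, h1⟩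
  rintro rfl
  rw [map_zero] at h1
  exact mul_ne_zero hf ((map_ne_zero_iff _ toFunctionField_injective).2
    (nonZeroDivisors.ne_zero b.2)) h1

theorem ord_toFunctionField_of_notMem [IsNoetherianRing R] {g : R} (x : Spec R)
    (hg : g ∉ x.asIdeal) : Scheme.ord (toFunctionField R g) x = 0 :=
  ord_eq_zero_of_notMem x hg

theorem functionFieldHom_toFunctionField {S : CommRingCat.{u}} [IsDomain S]
    (φ : R ⟶ S) [IsOpenImmersion (Spec.map φ)] (r : R) :
    functionFieldHom (Spec.map φ) (toFunctionField R r) = toFunctionField S (φ r) :=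
  functionFieldHom_spec φ r

theorem ord_pow_mul [IsNoetherianRing R] {ϖ : R} (hϖ : Prime ϖ) (x : Spec R)
    (hx : x.asIdeal = Ideal.span {ϖ}) (n : ℕ) {g : R} (hg : ¬ ϖ ∣ g) :
    Scheme.ord (toFunctionField R (ϖ ^ n * g)) x = n := by
  have hϖ0 := (map_ne_zero_iff _ toFunctionField_injective).2 hϖ.ne_zero
  have hg0 := (map_ne_zero_iff _ toFunctionField_injective).2
    (show g ≠ 0 by rintro rfl; exact hg (dvd_zero _))
  have hpow : ∀ m : ℕ, Scheme.ord (toFunctionField R ϖ ^ m) x = m := by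
    intro m
    induction m with
    | zero =>
      rw [pow_zero, ← map_one (toFunctionField R)]
      exact ord_toFunctionField_of_notMem x fun h => x.2.ne_top ((Ideal.eq_top_iff_one _).2 h)
    | succ m ih =>
      rw [pow_succ, Scheme.ord_mul (pow_ne_zero _ hϖ0) hϖ0, ih]
      simp [toFunctionField, (ord_uniformizer hϖ x hx).2]
  rw [map_mul, map_pow, Scheme.ord_mul (pow_ne_zero _ hϖ0) hg0, hpow,
    ord_toFunctionField_of_notMem x, add_zero]
  rwa [hx, Ideal.mem_span_singleton]

theorem ord_pos_of_dvd [IsNoetherianRing R] {ϖ : R} (hϖ : Prime ϖ) (x : Spec R)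
    (hx : x.asIdeal = Ideal.span {ϖ}) {g : R} (hg0 : g ≠ 0) (hg : ϖ ∣ g) :
    0 < Scheme.ord (toFunctionField R g) x := by
  obtain ⟨n, c, hc, rfl⟩ := WfDvdMonoid.max_power_factor hg0 hϖ.irreducible
  rw [ord_pow_mul hϖ x hx n hc]
  refine Nat.cast_pos.2 (Nat.pos_of_ne_zero ?_)
  rintro rfl
  rw [pow_zero, one_mul] at hg
  exact hc hg

/-- Reads off orders at a prime of `R` that need not be principal, once it becomes principal on an
open affine piece. -/
theorem ord_of_isOpenImmersion [IsNoetherianRing R] {S : CommRingCat.{u}} [IsDomain S]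
    [IsNoetherianRing S] (φ : R ⟶ S) [IsOpenImmersion (Spec.map φ)] {ϖ : S} (hϖ : Prime ϖ)
    (y : Spec S) (hy : y.asIdeal = Ideal.span {ϖ}) :
    Order.coheight (Spec.map φ y) = 1 ∧ ∀ (r : R) (n : ℕ) (g : S), φ r = ϖ ^ n * g → ¬ ϖ ∣ g →
      Scheme.ord (toFunctionField R r) (Spec.map φ y) = n := by
  refine ⟨(coheight_eq_of_isOpenImmersion _).trans (ord_uniformizer hϖ y hy).1,
    fun r n g hr hg => ?_⟩
  rw [← ord_functionFieldHom, functionFieldHom_toFunctionField, hr, ord_pow_mul hϖ y hy n hg]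

end Affine

/-! ### Restriction of Weil divisors to open subschemes -/

namespace WeilDivisor

variable {X U : Scheme.{u}} [IsIntegral X] [IsIntegral U] [IsLocallyNoetherian X]
  [IsLocallyNoetherian U] (j : U ⟶ X) [IsOpenImmersion j] {I : Set X} {J : Set U}
  {D : WeilDivisor X I} {E : WeilDivisor U J}

theorem IsPrincipalOn.preimage (h : ∀ y, E.coeff y = D.coeff (j y)) {V : X.Opens}
    (hD : D.IsPrincipalOn V) : E.IsPrincipalOn (j ⁻¹ᵁ V) := by
  obtain ⟨f, hf, hD⟩ := hD
  refine ⟨functionFieldHom j f, (map_ne_zero _).2 hf, fun y hy hco => ?_⟩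
  rw [h, ord_functionFieldHom, hD _ hy ((coheight_eq_of_isOpenImmersion j).trans hco)]

theorem IsPrincipalOn.image (h : ∀ y, E.coeff y = D.coeff (j y)) {W : U.Opens}
    (hE : E.IsPrincipalOn W) : D.IsPrincipalOn (j ''ᵁ W) := by
  obtain ⟨f, hf, hE⟩ := hE
  obtain ⟨f, rfl⟩ := (functionFieldHom_bijective j).2 f
  refine ⟨f, fun h => hf (by rw [h, map_zero]), ?_⟩
  rintro _ ⟨y, hy, rfl⟩ hco
  exact (h y).symm.trans ((hE y hy ((coheight_eq_of_isOpenImmersion j).symm.trans hco)).trans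
    (ord_functionFieldHom j f y))

end WeilDivisor

/-! ### Homogeneous primes of monoid algebras -/

section Homogeneous

variable {M : Type v} [AddCommGroup M] (k : Type u) [Field k] {S T : AddSubmonoid M}

theorem sum_single_coeff (g : AddMonoidAlgebra k S) :
    ∑ s ∈ g.coeff.support, AddMonoidAlgebra.single s (g.coeff s) = g := by
  refine AddMonoidAlgebra.coeff_injective ?_
  rw [AddMonoidAlgebra.coeff_sum]
  exact g.coeff.sum_single

theorem mem_of_single_coeff_mem {I : Ideal (AddMonoidAlgebra k S)} {g : AddMonoidAlgebra k S}
    (h : ∀ s, AddMonoidAlgebra.single s (g.coeff s) ∈ I) : g ∈ I := by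
  rw [← sum_single_coeff k g]
  exact Ideal.sum_mem _ fun s _ => h s

theorem single_mem_iff {I : Ideal (AddMonoidAlgebra k S)} (s : S) {a : k} (ha : a ≠ 0) :
    AddMonoidAlgebra.single s a ∈ I ↔ AddMonoidAlgebra.single s 1 ∈ I := by
  have h (b c : k) (hb : AddMonoidAlgebra.single s b ∈ I) :
      AddMonoidAlgebra.single s (c * b) ∈ I := by
    have := I.mul_mem_left (AddMonoidAlgebra.single 0 c) hb
    rwa [AddMonoidAlgebra.single_mul_single, zero_add] at this
  exact ⟨fun hs => by simpa [ha] using h a a⁻¹ hs, fun hs => by simpa using h 1 a hs⟩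

theorem mem_invariantPoints_iff (p : Spec (coordRing k S)) :
    p ∈ invariantPoints k S ↔
      ∀ g ∈ (PrimeSpectrum.asIdeal p : Ideal (AddMonoidAlgebra k S)), ∀ s : S,
        AddMonoidAlgebra.single s (g.coeff s) ∈
          (PrimeSpectrum.asIdeal p : Ideal (AddMonoidAlgebra k S)) := by
  classical
  have key (g : AddMonoidAlgebra k S) (s : S) :
      (DirectSum.decompose (AddMonoidAlgebra.grade k : S → Submodule k (AddMonoidAlgebra k S)) g s :
        AddMonoidAlgebra k S) = AddMonoidAlgebra.single s (g.coeff s) := by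
    induction g using AddMonoidAlgebra.induction_linear with
    | zero => simp
    | add a b ha hb =>
      rw [DirectSum.decompose_add, DirectSum.add_apply, Submodule.coe_add, ha, hb,
        AddMonoidAlgebra.coeff_add, Finsupp.add_apply, AddMonoidAlgebra.single_add]
    | single t a =>
      rw [AddMonoidAlgebra.grade.decompose_single, DirectSum.coe_of_apply]
      by_cases h : t = s <;> simp [h]
  refine ⟨fun h g hg s => ?_, fun h s g hg => ?_⟩
  · have := h s hg
    convert this
    exact (key g s).symm
  · convert h g hg s
    exact key g s

theorem coeff_orbitHom (g : AddMonoidAlgebra k S) (s : S) (hs : -(s : M) ∈ S) :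
    (orbitHom k S g).coeff (s : M) = g.coeff s := by
  classical
  induction g using AddMonoidAlgebra.induction_linear with
  | zero => simp
  | add a b ha hb => simp [ha, hb]
  | single t a =>
    rw [orbitHom, AddMonoidAlgebra.lift_single]
    by_cases ht : t = s
    · subst ht
      simp [hs]
    · have ht' : (t : M) ≠ s := fun h => ht (Subtype.ext h)
      by_cases h : -(t : M) ∈ S <;> simp [h, ht, ht']

theorem orbitHom_eq_zero_iff (g : AddMonoidAlgebra k S) :
    orbitHom k S g = 0 ↔ ∀ s : S, -(s : M) ∈ S → g.coeff s = 0 := by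
  refine ⟨fun h s hs => by rw [← coeff_orbitHom k g s hs, h]; rfl, fun h => ?_⟩
  rw [← sum_single_coeff k g, map_sum]
  refine Finset.sum_eq_zero fun s _ => ?_
  by_cases hs : -(s : M) ∈ S
  · simp [h s hs]
  · rw [orbitHom, AddMonoidAlgebra.lift_single]
    simp [hs]

theorem coeff_coordMap (h : S ≤ T) (g : AddMonoidAlgebra k S) (s : S) :
    (coordMap k h g).coeff (AddSubmonoid.inclusion h s) = g.coeff s :=
  Finsupp.mapDomain_apply (AddSubmonoid.inclusion_injective h) _ _

theorem coeff_coordMap_of_notMem (h : S ≤ T) (g : AddMonoidAlgebra k S) (t : T)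
    (ht : (t : M) ∉ S) : (coordMap k h g).coeff t = 0 :=
  Finsupp.mapDomain_of_notMem_range _ _ (by rintro ⟨s, rfl⟩; exact ht s.2)

theorem coeff_mul_single (g : AddMonoidAlgebra k S) (u s : S) (a : k) :
    (g * AddMonoidAlgebra.single u a).coeff (s + u) = g.coeff s * a :=
  AddMonoidAlgebra.coeff_mul_single_eq_coeff_mul _ (by simp)

theorem single_pow_one (u : S) (n : ℕ) : (AddMonoidAlgebra.single u 1 : AddMonoidAlgebra k S) ^ n =
    AddMonoidAlgebra.single (n • u) 1 := by
  rw [AddMonoidAlgebra.single_pow, one_pow]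

/-- An element of `k[S + ℕ(-u)]` is a quotient of an element of `k[S]` by a power of `t^u`. -/
theorem exists_mul_single_eq_coordMap (h : S ≤ T) (u : S) (hT : T = localization S u)
    (g : AddMonoidAlgebra k T) :
    ∃ (n : ℕ) (r : AddMonoidAlgebra k S),
      g * AddMonoidAlgebra.single (n • AddSubmonoid.inclusion h u) 1 = coordMap k h r := by
  let := (coordMap k h).toAlgebra
  have := isLocalization_away k h u hT
  obtain ⟨⟨r, ⟨_, n, rfl⟩⟩, hr⟩ := IsLocalization.surj
    (Submonoid.powers (AddMonoidAlgebra.single u 1 : AddMonoidAlgebra k S)) g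
  refine ⟨n, r, Eq.trans ?_ hr⟩
  change _ = g * coordMap k h (AddMonoidAlgebra.single u 1 ^ n)
  rw [single_pow_one, coordMap_single, map_nsmul]

/-- Multiplying by a power of the unit `t^u` clears denominators and merely shifts degrees, so
homogeneity can be tested on either side of the localization. -/
theorem mem_invariantPoints_comap (h : S ≤ T) (u : S) (hT : T = localization S u)
    (p : Spec (coordRing k T)) :
    Spec.map (CommRingCat.ofHom (coordMap k h)) p ∈ invariantPoints k S ↔
      p ∈ invariantPoints k T := by
  rw [mem_invariantPoints_iff, mem_invariantPoints_iff]
  let P : Ideal (AddMonoidAlgebra k T) := PrimeSpectrum.asIdeal p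
  change (∀ g, coordMap k h g ∈ P → ∀ s, coordMap k h (AddMonoidAlgebra.single s (g.coeff s)) ∈ P) ↔
    ∀ g ∈ P, ∀ t, AddMonoidAlgebra.single t (g.coeff t) ∈ P
  constructor
  · intro H g hg t
    obtain ⟨n, r, hr⟩ := exists_mul_single_eq_coordMap k h u hT g
    let w : T := n • AddSubmonoid.inclusion h u
    have hw : -(w : M) ∈ T := by
      have : -(w : M) ∈ localization S (u : M) := mem_localization.2 ⟨n, by simp [w]⟩
      rwa [← hT] at this
    have hrP : coordMap k h r ∈ P := hr ▸ P.mul_mem_right _ hg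
    have hc : (coordMap k h r).coeff (t + w) = g.coeff t := by
      rw [← hr, coeff_mul_single, mul_one]
    by_cases htw : ((t + w : T) : M) ∈ S
    · have h1 := H r hrP ⟨_, htw⟩
      rw [coordMap_single, ← coeff_coordMap k h] at h1
      have h2 := P.mul_mem_right (AddMonoidAlgebra.single (⟨_, hw⟩ : T) 1) h1
      rw [AddMonoidAlgebra.single_mul_single, mul_one] at h2
      convert h2 using 2
      · ext
        simp
      · exact hc.symm
    · rw [← hc, coeff_coordMap_of_notMem k h r _ htw]
      simp
  · intro H g hg s
    have := H _ hg (AddSubmonoid.inclusion h s)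
    rwa [coeff_coordMap, ← coordMap_single] at this

variable [Module.Free ℤ M]

theorem mem_orbitPoint_iff (g : AddMonoidAlgebra k S) :
    g ∈ (PrimeSpectrum.asIdeal (orbitPoint k S) : Ideal (AddMonoidAlgebra k S)) ↔
      ∀ s : S, -(s : M) ∈ S → g.coeff s = 0 :=
  orbitHom_eq_zero_iff k g

/-- If `g` in a homogeneous prime had a nonzero coefficient at an invertible `s`, the prime would
contain the unit `t^s`. -/
theorem specializes_orbitPoint {p : Spec (coordRing k S)} (hp : p ∈ invariantPoints k S) :
    p ⤳ orbitPoint k S := by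
  refine (PrimeSpectrum.le_iff_specializes _ _).1 ?_
  intro g hg
  refine (mem_orbitPoint_iff k g).2 fun s hs => ?_
  by_contra h
  have h1 := (mem_invariantPoints_iff k p).1 hp g hg s
  rw [single_mem_iff k s h] at h1
  have h2 := Ideal.mul_mem_right (AddMonoidAlgebra.single (⟨_, hs⟩ : S) 1) _ h1
  rw [AddMonoidAlgebra.single_mul_single, mul_one] at h2
  refine p.2.ne_top ((Ideal.eq_top_iff_one _).2 ?_)
  convert h2
  rw [AddMonoidAlgebra.one_def]
  congr 1
  ext
  simp

end Homogeneous

/-! ### Passage between `X_Δ` and its charts; the order of a class -/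

namespace MonoidFan

variable {M : Type v} [AddCommGroup M] (Δ : MonoidFan M) {k : Type u} [Field k]

/-- Invariance on some chart implies invariance on every chart containing the point: two
representatives of one point come from a common localization, through which homogeneity is
transported. -/
theorem chartι_mem_invariantPoints_iff (S : Δ.Chart) (y : Spec (coordRing k S.1)) :
    Δ.chartι k S y ∈ Δ.invariantPoints k ↔ y ∈ Toric.invariantPoints k S.1 := by
  refine ⟨?_, fun h => ⟨S, y, h, rfl⟩⟩
  rintro ⟨T, p, hp, h⟩
  obtain ⟨R, fT, fS, z, hzT, hzS⟩ := (Scheme.IsLocallyDirected.ι_eq_ι_iff (Δ.chartDiagram k)).1 h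
  obtain ⟨u, hu⟩ := Δ.exists_eq_localization (leOfHom fT.unop)
  obtain ⟨w, hw⟩ := Δ.exists_eq_localization (leOfHom fS.unop)
  have h1 := (mem_invariantPoints_comap k (leOfHom fT.unop) u hu z).1 (by rw [← hzT] at hp; exact hp)
  have h2 := (mem_invariantPoints_comap k (leOfHom fS.unop) w hw z).2 h1
  rw [← hzS]
  exact h2

theorem coeff_restrict (S : Δ.Chart) (D : Δ.ToricWeilDivisor k) (y : Spec (coordRing k S.1)) :
    (Δ.restrict S D).coeff y = D.coeff (Δ.chartι k S y) := by
  have h : (Order.coheight y = 1 ∧ y ∈ Toric.invariantPoints k S.1) ↔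
      (Order.coheight (Δ.chartι k S y) = 1 ∧ Δ.chartι k S y ∈ Δ.invariantPoints k) := by
    rw [chartι_mem_invariantPoints_iff, coheight_eq_of_isOpenImmersion (Δ.chartι k S)]
  unfold WeilDivisor.coeff
  by_cases hy : Order.coheight y = 1 ∧ y ∈ Toric.invariantPoints k S.1
  · rw [dif_pos hy, dif_pos (h.1 hy)]
    rfl
  · rw [dif_neg hy, dif_neg (mt h.2 hy)]

variable [Module.Free ℤ M]

/-- Every component of `D` that meets the chart is an invariant prime there, so its closure contains
the orbit point. -/
theorem toCl_eq_zero_of_notMem {S : Δ.Chart} {D : Δ.ToricWeilDivisor k} (hS : S ∉ Δ.chartsOn D) :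
    Δ.toCl S D = 0 := by
  suffices h : Δ.restrict S D = 0 by rw [toCl, h]; rfl
  ext p
  by_contra hp
  refine hS ?_
  classical
  refine (Finset.mem_filter.2 ⟨Finset.mem_attach _ _, Δ.ofChart S p, hp, ?_⟩)
  rw [← specializes_iff_mem_closure]
  exact (specializes_orbitPoint k p.2.2).map (Δ.chartι k S).continuous

theorem toG_eq_zero_iff (D : Δ.ToricWeilDivisor k) : Δ.toG D = 0 ↔ ∀ S, Δ.toCl S D = 0 := by
  simp only [toG, toCl, QuotientAddGroup.eq_zero_iff]
  constructor
  · intro h S y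
    obtain ⟨V, hV, hD⟩ := h (Δ.chartι k S y)
    exact ⟨_, hV, WeilDivisor.IsPrincipalOn.preimage _ (Δ.coeff_restrict S D) hD⟩
  · intro h x
    obtain ⟨S, y, rfl⟩ := Δ.exists_chartι_eq k x
    obtain ⟨W, hW, hD⟩ := h S y
    exact ⟨Δ.chartι k S ''ᵁ W, ⟨y, hW, rfl⟩,
      WeilDivisor.IsPrincipalOn.image _ (Δ.coeff_restrict S D) hD⟩

theorem nsmul_toG_eq_zero_iff (D : Δ.ToricWeilDivisor k) (n : ℕ) :
    n • Δ.toG D = 0 ↔ ∀ S ∈ Δ.chartsOn D, n • Δ.toCl S D = 0 := by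
  have h1 : n • Δ.toG D = Δ.toG (n • D) := rfl
  have h2 (S : Δ.Chart) : n • Δ.toCl S D = Δ.toCl S (n • D) := by
    rw [toCl, toCl, map_nsmul]; rfl
  rw [h1, toG_eq_zero_iff]
  simp only [← h2]
  refine ⟨fun h S _ => h S, fun h S => ?_⟩
  by_cases hS : S ∈ Δ.chartsOn D
  · exact h S hS
  · rw [toCl_eq_zero_of_notMem Δ hS, smul_zero]

theorem addOrderOf_toG (D : Δ.ToricWeilDivisor k) :
    addOrderOf (Δ.toG D) = (Δ.chartsOn D).lcm fun S => addOrderOf (Δ.toCl S D) := by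
  refine Nat.dvd_antisymm ?_ (Finset.lcm_dvd fun S hS => ?_)
  · rw [addOrderOf_dvd_iff_nsmul_eq_zero, nsmul_toG_eq_zero_iff]
    exact fun S hS => addOrderOf_dvd_iff_nsmul_eq_zero.1
      (Finset.dvd_lcm (f := fun S => addOrderOf (Δ.toCl S D)) hS)
  · rw [addOrderOf_dvd_iff_nsmul_eq_zero]
    exact (nsmul_toG_eq_zero_iff Δ D _).1 (addOrderOf_nsmul_eq_zero _) S hS

theorem exists_ofChart_eq (D : Δ.ToricPrimeDivisor k) {S : Δ.Chart}
    (hS : S ∈ Δ.chartsOn (Finsupp.single D 1)) :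
    ∃ p : AffinePrimeDivisor k S.1,
      Δ.ofChart S p = D ∧ Δ.restrict S (Finsupp.single D 1) = Finsupp.single p 1 := by
  classical
  obtain ⟨E, hE, hcl⟩ := (Finset.mem_filter.1 hS).2
  have hED : E = D := by
    by_contra h
    exact hE (Finsupp.single_eq_of_ne h)
  rw [hED] at hcl
  rw [← specializes_iff_mem_closure] at hcl
  -- An open set containing a specialization of `D` contains the generic point of `D` itself.
  obtain ⟨y, hy⟩ : D.1 ∈ Set.range (Δ.chartι k S) :=
    hcl.mem_open (Δ.chartι k S).isOpenEmbedding.isOpen_range ⟨_, rfl⟩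
  let p : AffinePrimeDivisor k S.1 :=
    ⟨y, (coheight_eq_of_isOpenImmersion (Δ.chartι k S)).symm.trans (hy ▸ D.2.1),
      (Δ.chartι_mem_invariantPoints_iff S y).1 (hy ▸ D.2.2)⟩
  have hp : Δ.ofChart S p = D := Subtype.ext hy
  refine ⟨p, hp, ?_⟩
  rw [← hp]
  ext q
  change Finsupp.single (Δ.ofChart S p) (1 : ℤ) (Δ.ofChart S q) = _
  simp only [Finsupp.single_apply, (Δ.ofChart_injective S).eq_iff]

end MonoidFan

/-! ### Factoriality of the Laurent polynomial ring `k[M]` -/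

section Laurent

variable {M : Type v} [AddCommGroup M] {ι : Type*} (b : Module.Basis ι ℤ M) (k : Type u) [Field k]

/-- The monoid of the elements with nonnegative coordinates. -/
def orthant : AddSubmonoid M where
  carrier := {u | ∀ i, 0 ≤ b.repr u i}
  zero_mem' := by simp
  add_mem' := fun {u w} hu hw i => by
    rw [map_add]
    exact add_nonneg (hu i) (hw i)

/-- The elements with nonnegative coordinates, described by their coordinates. -/
noncomputable def orthantHom : (ι →₀ ℕ) →+ orthant b where
  toFun f := ⟨b.repr.symm (f.mapRange Nat.cast Nat.cast_zero), fun i => by simp⟩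
  map_zero' := by ext; simp
  map_add' f g := by
    ext1
    simp [Finsupp.mapRange_add]

theorem orthantHom_bijective : Function.Bijective (orthantHom b) := by
  constructor
  · intro f g h
    exact Finsupp.mapRange_injective _ _ Nat.cast_injective
      (b.repr.symm.injective (congrArg Subtype.val h))
  · rintro ⟨u, hu⟩
    refine ⟨(b.repr u).mapRange Int.toNat rfl, Subtype.ext (b.repr.injective ?_)⟩
    ext i
    simpa [orthantHom] using hu i

theorem uniqueFactorizationMonoid_orthant :
    UniqueFactorizationMonoid (AddMonoidAlgebra k (orthant b)) :=
  (AddMonoidAlgebra.domCongr k k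
    (AddEquiv.ofBijective _ (orthantHom_bijective b))).toMulEquiv.uniqueFactorizationMonoid
      (inferInstanceAs (UniqueFactorizationMonoid (MvPolynomial ι k)))

theorem top_eq_localization_orthant [Finite ι] :
    ∃ w : orthant b, (⊤ : AddSubmonoid M) = localization (orthant b) (w : M) := by
  classical
  have := Fintype.ofFinite ι
  let w : M := ∑ i, b i
  have hw (i) : b.repr w i = 1 := by simp [w, Finsupp.single_apply]
  refine ⟨⟨w, fun i => by rw [hw]; exact zero_le_one⟩,
    (eq_top_iff.2 fun u _ => mem_localization.2 ?_).symm⟩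
  -- Every coordinate of `w` is `1`, so this single multiple outweighs all negative coordinates of
  -- `u`.
  refine ⟨∑ i, (b.repr u i).natAbs, fun i => ?_⟩
  have h1 : (b.repr u i).natAbs ≤ ∑ i, (b.repr u i).natAbs :=
    Finset.single_le_sum (f := fun i => (b.repr u i).natAbs) (fun _ _ => Nat.zero_le _)
      (Finset.mem_univ i)
  rw [map_add, map_nsmul, Finsupp.add_apply, Finsupp.smul_apply, hw]
  simp only [nsmul_eq_mul, mul_one]
  omega

variable (M) in
-- `k[M]` is the localization of a polynomial ring at the product of its variables.
theorem uniqueFactorizationMonoid_top [Module.Free ℤ M] [Module.Finite ℤ M] :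
    UniqueFactorizationMonoid (AddMonoidAlgebra k (⊤ : AddSubmonoid M)) := by
  let b := Module.Free.chooseBasis ℤ M
  obtain ⟨w, hw⟩ := top_eq_localization_orthant b
  let := (coordMap k (le_top : orthant b ≤ ⊤)).toAlgebra
  have := isLocalization_away k le_top w hw
  have := uniqueFactorizationMonoid_orthant b k
  exact UniqueFactorizationMonoid.of_isLocalization
    (Submonoid.powers (AddMonoidAlgebra.single w 1 : AddMonoidAlgebra k (orthant b))) _

end Laurent

/-! ### Half-space monoids, where the orbit prime is principal -/

section HalfSpace

variable {M : Type v} [AddCommGroup M] (f : M →+ ℤ) (k : Type u) [Field k]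

/-- The monoid of the `u ∈ M` with `f u ≥ 0`. -/
def halfSpace : AddSubmonoid M where
  carrier := {u | 0 ≤ f u}
  zero_mem' := by simp
  add_mem' {u w} hu hw := by
    rw [Set.mem_ofPred_eq, map_add]
    exact add_nonneg hu hw

variable {f} in
theorem mem_halfSpace {u : M} : u ∈ halfSpace f ↔ 0 ≤ f u := Iff.rfl

theorem single_pow_dvd_iff {a : halfSpace f} (ha : f a = 1) (n : ℕ)
    (g : AddMonoidAlgebra k (halfSpace f)) :
    AddMonoidAlgebra.single a 1 ^ n ∣ g ↔ ∀ t : halfSpace f, g.coeff t ≠ 0 → (n : ℤ) ≤ f t := by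
  classical
  rw [single_pow_one]
  constructor
  · rintro ⟨g, rfl⟩ t ht
    obtain ⟨s, hs, rfl⟩ := Finset.mem_image.1 (AddMonoidAlgebra.support_coeff_single_mul_subset _ _ _
      (Finsupp.mem_support_iff.2 ht))
    have := mem_halfSpace.1 s.2
    simp [ha, this]
  · intro h
    rw [← sum_single_coeff k g]
    refine Finset.dvd_sum fun t ht => ?_
    have h1 := h t (Finsupp.mem_support_iff.1 ht)
    refine ⟨AddMonoidAlgebra.single ⟨t - n • a, ?_⟩ (g.coeff t), ?_⟩
    · simp [mem_halfSpace, ha, h1]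
    · rw [AddMonoidAlgebra.single_mul_single, one_mul]
      congr 1
      ext
      simp

variable [Module.Free ℤ M]

/-- The invertible exponents are those with `f = 0`. All others have `f ≥ 1`, so their monomials are
multiples of `t^a`. -/
theorem asIdeal_orbitPoint_halfSpace {a : halfSpace f} (ha : f a = 1) :
    (PrimeSpectrum.asIdeal (orbitPoint k (halfSpace f)) :
      Ideal (AddMonoidAlgebra k (halfSpace f))) = Ideal.span {AddMonoidAlgebra.single a 1} := by
  ext g
  rw [mem_orbitPoint_iff, Ideal.mem_span_singleton,
    ← pow_one (AddMonoidAlgebra.single a 1), single_pow_dvd_iff f k ha]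
  refine forall_congr' fun t => ?_
  have ht := mem_halfSpace.1 t.2
  rw [mem_halfSpace, map_neg, ← not_imp_not]
  refine imp_congr_right fun _ => ?_
  simp only [Nat.cast_one]
  omega

theorem prime_single {a : halfSpace f} (ha : f a = 1) :
    Prime (AddMonoidAlgebra.single a 1 : AddMonoidAlgebra k (halfSpace f)) := by
  rw [← Ideal.span_singleton_prime (by simp), ← asIdeal_orbitPoint_halfSpace f k ha]
  exact (orbitPoint k (halfSpace f)).2

end HalfSpace

/-! ### Monoids cut out by independent linear forms -/

theorem exists_nsmul_add_nonneg {M ι : Type*} [AddCommGroup M] [Finite ι] (v : ι → M →+ ℤ) (u : M)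
    (i : ι) {w : M} (hw : ∀ j, j ≠ i → 0 < v j w) :
    ∃ n : ℕ, ∀ j, j ≠ i → 0 ≤ v j (u + n • w) := by
  have := Fintype.ofFinite ι
  refine ⟨∑ j, (v j u).natAbs, fun j hj => ?_⟩
  have h1 : (v j u).natAbs ≤ ∑ j, (v j u).natAbs :=
    Finset.single_le_sum (f := fun j => (v j u).natAbs) (fun _ _ => Nat.zero_le _)
      (Finset.mem_univ j)
  have h2 := hw j hj
  rw [map_add, map_nsmul, nsmul_eq_mul]
  have h3 : ((v j u).natAbs : ℤ) ≤ (∑ j, (v j u).natAbs : ℕ) := by exact_mod_cast h1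
  nlinarith [neg_abs_le (v j u), Int.natCast_natAbs (v j u)]

/-- The monoid `S` consists of the `u` with `v i u ≥ 0` for all `i`, the form `v i` takes the value
`1`, and it vanishes at some `u` where all the other forms are positive. -/
structure IsCutOutBy {M : Type v} [AddCommGroup M] {ι : Type*} (S : AddSubmonoid M)
    (v : ι → M →+ ℤ) : Prop where
  mem_iff : ∀ u, u ∈ S ↔ ∀ i, 0 ≤ v i u
  exists_eq_one : ∀ i, ∃ u, v i u = 1
  exists_pos : ∀ i, ∃ u, v i u = 0 ∧ ∀ j, j ≠ i → 0 < v j u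

namespace IsCutOutBy

variable {M : Type v} [AddCommGroup M] {ι : Type*} {S : AddSubmonoid M}
  {v : ι → M →+ ℤ} (h : IsCutOutBy S v)
include h

theorem le_halfSpace (i : ι) : S ≤ halfSpace (v i) := fun _ hu => (h.mem_iff _).1 hu i

theorem exists_mem_eq_zero (i : ι) : ∃ u ∈ S, v i u = 0 ∧ ∀ j, j ≠ i → 0 < v j u := by
  obtain ⟨u, hu, hj⟩ := h.exists_pos i
  refine ⟨u, (h.mem_iff u).2 fun j => ?_, hu, hj⟩
  by_cases hji : j = i
  · rw [hji, hu]
  · exact (hj j hji).le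

variable [Finite ι]

theorem exists_mem_eq_one (i : ι) : ∃ u ∈ S, v i u = 1 := by
  obtain ⟨u, hu⟩ := h.exists_eq_one i
  obtain ⟨w, hw, hw0, hj⟩ := h.exists_mem_eq_zero i
  obtain ⟨n, hn⟩ := exists_nsmul_add_nonneg v u i hj
  have h1 : v i (u + n • w) = 1 := by simp [hu, hw0]
  refine ⟨u + n • w, (h.mem_iff _).2 fun j => ?_, h1⟩
  by_cases hji : j = i
  · rw [hji, h1]; exact zero_le_one
  · exact hn j hji

/-- Inverting an element on which only `v i` vanishes removes every inequality except the `i`-th. -/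
theorem halfSpace_eq_localization (i : ι) : ∃ u : S, halfSpace (v i) = localization S (u : M) := by
  obtain ⟨w, hw, hw0, hj⟩ := h.exists_mem_eq_zero i
  refine ⟨⟨w, hw⟩, le_antisymm (fun u hu => mem_localization.2 ?_) fun u hu => ?_⟩
  · obtain ⟨n, hn⟩ := exists_nsmul_add_nonneg v u i hj
    refine ⟨n, (h.mem_iff _).2 fun j => ?_⟩
    by_cases hji : j = i
    · rw [hji]; simpa [hw0] using mem_halfSpace.1 hu
    · exact hn j hji
  · obtain ⟨n, hn⟩ := mem_localization.1 hu
    exact mem_halfSpace.2 (by simpa [hw0] using (h.mem_iff _).1 hn i)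

theorem exists_forall_pos : ∃ u ∈ S, ∀ i, 0 < v i u := by
  have := Fintype.ofFinite ι
  choose a ha ha1 using h.exists_mem_eq_one
  refine ⟨∑ i, a i, S.sum_mem fun i _ => ha i, fun i => ?_⟩
  rw [map_sum]
  exact Finset.sum_pos' (fun j _ => (h.mem_iff _).1 (ha j) i)
    ⟨i, Finset.mem_univ i, by rw [ha1]; exact zero_lt_one⟩

theorem exists_nsmul_add_mem (u : M) {w : M} (hw : ∀ j, 0 < v j w) : ∃ n : ℕ, u + n • w ∈ S := by
  by_cases hι : Nonempty ι
  · obtain ⟨i⟩ := hι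
    obtain ⟨n, hn⟩ := exists_nsmul_add_nonneg v u i fun j _ => hw j
    -- `n` takes care of the forms other than `v i`; the extra summand takes care of `v i`, because
    -- `v i w ≥ 1`.
    refine ⟨n + (v i u).natAbs, (h.mem_iff _).2 fun j => ?_⟩
    have h1 := hw j
    rw [add_nsmul, ← add_assoc, map_add, map_nsmul _ _ w]
    by_cases hj : j = i
    · subst hj
      rw [map_add, map_nsmul, nsmul_eq_mul, nsmul_eq_mul, Int.natCast_natAbs]
      nlinarith [neg_abs_le (v j u), abs_nonneg (v j u)]
    · have := hn j hj
      positivity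
  · exact ⟨0, (h.mem_iff _).2 fun j => (hι ⟨j⟩).elim⟩

theorem top_eq_localization : ∃ u : S, (⊤ : AddSubmonoid M) = localization S (u : M) := by
  obtain ⟨w, hw, hpos⟩ := h.exists_forall_pos
  exact ⟨⟨w, hw⟩, (eq_top_iff.2 fun u _ =>
    mem_localization.2 (h.exists_nsmul_add_mem u hpos)).symm⟩

end IsCutOutBy

theorem fg_of_eq_localization {M : Type v} [AddCommGroup M] {S T : AddSubmonoid M}
    [hS : AddMonoid.FG S] {u : M} (hT : T = localization S u) : AddMonoid.FG T := by
  rw [AddMonoid.fg_iff_addSubmonoid_fg] at hS ⊢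
  rw [hT]
  exact hS.sup ⟨{-u}, by rw [Finset.coe_singleton, AddSubmonoid.multiples_eq_closure]⟩

instance isDomain_coordRing {M : Type v} [AddCommGroup M] [Module.Free ℤ M] (k : Type u) [Field k]
    (S : AddSubmonoid M) : IsDomain (coordRing k S) :=
  isDomain_monoidAlgebra k S

instance isNoetherianRing_coordRing {M : Type v} [AddCommGroup M] (k : Type u) [Field k]
    (S : AddSubmonoid M) [AddMonoid.FG S] : IsNoetherianRing (coordRing k S) :=
  isNoetherianRing_monoidAlgebra k S

/-! ### Invariant prime divisors of `Spec k[S]` and orders along them -/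

namespace IsCutOutBy

variable {M : Type v} [AddCommGroup M] {ι : Type*} {S : AddSubmonoid M}
  {v : ι → M →+ ℤ} (h : IsCutOutBy S v) (k : Type u) [Field k]

section EdgePoint

variable [Module.Free ℤ M]

/-- The homogeneous prime of `k[S]` spanned by the `t^s` with `v i s > 0`. -/
noncomputable def edgePoint (i : ι) : Spec (coordRing k S) :=
  Spec.map (CommRingCat.ofHom (coordMap k (h.le_halfSpace i))) (orbitPoint k (halfSpace (v i)))

theorem mem_edgePoint_iff (i : ι) (g : AddMonoidAlgebra k S) :
    g ∈ (PrimeSpectrum.asIdeal (h.edgePoint k i) : Ideal (AddMonoidAlgebra k S)) ↔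
      ∀ s : S, v i s = 0 → g.coeff s = 0 := by
  have h1 : g ∈ (PrimeSpectrum.asIdeal (h.edgePoint k i) : Ideal (AddMonoidAlgebra k S)) ↔
      coordMap k (h.le_halfSpace i) g ∈ (PrimeSpectrum.asIdeal (orbitPoint k (halfSpace (v i))) :
        Ideal (AddMonoidAlgebra k (halfSpace (v i)))) := Iff.rfl
  rw [h1, mem_orbitPoint_iff]
  constructor
  · intro H s hs
    rw [← coeff_coordMap k (h.le_halfSpace i)]
    exact H _ (mem_halfSpace.2 (by rw [map_neg, AddSubmonoid.coe_inclusion, hs, neg_zero]))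
  · intro H t ht
    have h0 : v i t = 0 := by
      have h2 := mem_halfSpace.1 t.2
      have h3 := mem_halfSpace.1 ht
      rw [map_neg] at h3
      omega
    by_cases htS : (t : M) ∈ S
    · rw [← H ⟨t, htS⟩ h0, ← coeff_coordMap k (h.le_halfSpace i)]
      rfl
    · exact coeff_coordMap_of_notMem k _ _ _ htS

theorem single_mem_edgePoint_iff (i : ι) (s : S) :
    AddMonoidAlgebra.single s 1 ∈
      (PrimeSpectrum.asIdeal (h.edgePoint k i) : Ideal (AddMonoidAlgebra k S)) ↔ v i s ≠ 0 := by
  classical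
  rw [mem_edgePoint_iff]
  simp only [AddMonoidAlgebra.coeff_single, Finsupp.single_apply]
  constructor
  · intro H h0
    simpa using H s h0
  · intro H t ht
    rw [if_neg]
    rintro rfl
    exact H ht

theorem edgePoint_mem_invariantPoints (i : ι) : h.edgePoint k i ∈ invariantPoints k S := by
  classical
  rw [mem_invariantPoints_iff]
  intro g hg s
  rw [mem_edgePoint_iff] at hg ⊢
  intro t ht
  rw [AddMonoidAlgebra.coeff_single, Finsupp.single_apply]
  split_ifs with hst
  · rw [hst, hg t ht]
  · rfl

theorem edgePoint_injective : Function.Injective (h.edgePoint k) := by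
  intro i j hij
  by_contra hne
  obtain ⟨u, hu, h0, hpos⟩ := h.exists_mem_eq_zero i
  have h1 := (h.single_mem_edgePoint_iff k j ⟨u, hu⟩).2 (hpos j (Ne.symm hne)).ne'
  rw [← hij] at h1
  exact (h.single_mem_edgePoint_iff k i ⟨u, hu⟩).1 h1 h0

variable [Finite ι]

/-- Otherwise each `i` yields a monomial outside `q` with `v i` positive on its exponent. The
product of these is outside `q` and has all forms positive, so a power of it is divisible by `t^w ∈
q`. -/
theorem exists_edgePoint_le {q : Ideal (AddMonoidAlgebra k S)} [hq : q.IsPrime] {w : S}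
    (hw : AddMonoidAlgebra.single w 1 ∈ q) :
    ∃ i, (PrimeSpectrum.asIdeal (h.edgePoint k i) : Ideal (AddMonoidAlgebra k S)) ≤ q := by
  by_contra! H
  have := Fintype.ofFinite ι
  have key (i : ι) : ∃ s : S, 0 < v i s ∧ AddMonoidAlgebra.single s 1 ∉ q := by
    obtain ⟨g, hg, hgq⟩ := Set.not_subset.1 (H i)
    by_contra! hall
    refine hgq (mem_of_single_coeff_mem k fun s => ?_)
    by_cases hs : g.coeff s = 0
    · simp [hs]
    · rw [single_mem_iff k s hs]
      refine hall s (lt_of_le_of_ne ((h.mem_iff s).1 s.2 i) fun h0 => hs ?_)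
      exact (h.mem_edgePoint_iff k i g).1 hg s h0.symm
  choose s hs hsq using key
  have hsum : AddMonoidAlgebra.single (∑ i, s i) 1 ∉ q := by
    have hprod : (AddMonoidAlgebra.single (∑ i, s i) 1 : AddMonoidAlgebra k S) =
        ∏ i, AddMonoidAlgebra.single (s i) 1 := by
      exact map_prod (AddMonoidAlgebra.of k S) (fun i => Multiplicative.ofAdd (s i)) Finset.univ
    rw [hprod, hq.prod_mem_iff]
    rintro ⟨i, -, hi⟩
    exact hsq i hi
  have hpos (j : ι) : 0 < v j (∑ i, s i : S) := by
    rw [AddSubmonoid.coe_finsetSum, map_sum]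
    exact Finset.sum_pos' (fun i _ => (h.mem_iff _).1 (s i).2 j) ⟨j, Finset.mem_univ j, hs j⟩
  obtain ⟨n, hn⟩ := h.exists_nsmul_add_mem (-w) hpos
  have h1 := q.mul_mem_right (AddMonoidAlgebra.single ⟨_, hn⟩ 1) hw
  rw [AddMonoidAlgebra.single_mul_single, mul_one] at h1
  refine hsum (hq.mem_of_pow_mem n ?_)
  rw [single_pow_one]
  convert h1 using 2
  ext
  simp

variable [AddMonoid.FG S]

/-- On the open chart of the half-space of `v i` the prime is generated by `t^a` with `v i a = 1`;
the power of `t^a` dividing `g` is the least value of `v i` on its exponents. -/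
theorem ord_edgePoint (i : ι) :
    Order.coheight (h.edgePoint k i) = 1 ∧
      ∀ (g : AddMonoidAlgebra k S) (s : S), g.coeff s ≠ 0 →
        (∀ t : S, g.coeff t ≠ 0 → v i s ≤ v i t) →
        Scheme.ord (toFunctionField (coordRing k S) g)
          (h.edgePoint k i) = v i s := by
  obtain ⟨u, hu⟩ := h.halfSpace_eq_localization i
  have := isOpenImmersion_coordMap k (h.le_halfSpace i) u hu
  have : AddMonoid.FG (halfSpace (v i)) := fg_of_eq_localization hu
  obtain ⟨a, ha⟩ := h.exists_eq_one i
  let a' : halfSpace (v i) := ⟨a, mem_halfSpace.2 (by rw [ha]; exact zero_le_one)⟩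
  have ha' : v i a' = 1 := ha
  obtain ⟨h1, h2⟩ := ord_of_isOpenImmersion (CommRingCat.ofHom (coordMap k (h.le_halfSpace i)))
    (prime_single (v i) k ha') (orbitPoint k _) (asIdeal_orbitPoint_halfSpace (v i) k ha')
  refine ⟨h1, fun g s hs hmin => ?_⟩
  have hs0 : 0 ≤ v i s := (h.mem_iff s).1 s.2 i
  have hdvd : AddMonoidAlgebra.single a' 1 ^ (v i s).toNat ∣ coordMap k (h.le_halfSpace i) g := by
    rw [single_pow_dvd_iff (v i) k ha']
    intro t ht
    by_cases htS : (t : M) ∈ S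
    · have := hmin ⟨t, htS⟩ (by rwa [← coeff_coordMap k (h.le_halfSpace i)])
      rwa [Int.toNat_of_nonneg hs0]
    · exact absurd (coeff_coordMap_of_notMem k _ _ _ htS) ht
  have hnot : ¬ AddMonoidAlgebra.single a' 1 ^ ((v i s).toNat + 1) ∣
      coordMap k (h.le_halfSpace i) g := by
    rw [single_pow_dvd_iff (v i) k ha']
    intro H
    have h3 := H (AddSubmonoid.inclusion (h.le_halfSpace i) s) (by rwa [coeff_coordMap])
    rw [Nat.cast_add, Int.toNat_of_nonneg hs0] at h3
    simp at h3
  obtain ⟨g', hg'⟩ := hdvd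
  have h4 := h2 g _ g' hg' fun ⟨c, hc⟩ => hnot ⟨c, by rw [hg', hc, pow_succ, mul_assoc]⟩
  rw [Int.toNat_of_nonneg hs0] at h4
  exact h4

theorem ord_single_edgePoint (i : ι) (s : S) :
    Scheme.ord (toFunctionField (coordRing k S)
      (AddMonoidAlgebra.single s 1)) (h.edgePoint k i) = v i s := by
  classical
  refine (h.ord_edgePoint k i).2 _ s (by simp) fun t ht => ?_
  rw [AddMonoidAlgebra.coeff_single, Finsupp.single_apply] at ht
  split_ifs at ht with hst
  · rw [hst]
  · exact absurd rfl ht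

theorem eq_edgePoint_of_single_mem {x : Spec (coordRing k S)} (hx : Order.coheight x = 1) {w : S}
    (hw : AddMonoidAlgebra.single w 1 ∈
      (PrimeSpectrum.asIdeal x : Ideal (AddMonoidAlgebra k S))) : ∃ i, x = h.edgePoint k i := by
  have hxp : (PrimeSpectrum.asIdeal x : Ideal (AddMonoidAlgebra k S)).IsPrime := x.2
  obtain ⟨i, hi⟩ := h.exists_edgePoint_le k hw
  refine ⟨i, ?_⟩
  -- The order on the points of a scheme reverses inclusion of primes, so `coheight` is the
  -- codimension. Both points have codimension one, so the inclusion is an equality.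
  have hle : x ≤ h.edgePoint k i := (PrimeSpectrum.le_iff_specializes _ _).1 hi
  by_contra hne
  have hlt : x < h.edgePoint k i := lt_of_le_not_ge hle fun hge =>
    hne (PrimeSpectrum.ext (le_antisymm ((PrimeSpectrum.le_iff_specializes _ _).2 hge) hi))
  have h1 := Order.coheight_add_one_le hlt
  rw [hx, (h.ord_edgePoint k i).1] at h1
  exact absurd h1 (by decide)

/-- A nonzero homogeneous prime contains a monomial. -/
theorem eq_edgePoint_of_mem_invariantPoints {x : Spec (coordRing k S)}
    (hx : Order.coheight x = 1) (hinv : x ∈ invariantPoints k S) : ∃ i, x = h.edgePoint k i := by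
  have hne : (PrimeSpectrum.asIdeal x : Ideal (AddMonoidAlgebra k S)) ≠ ⊥ := by
    intro hbot
    have h1 := idealHeight_eq_coheight (coordRing k S) x
    rw [hx] at h1
    have h2 : (PrimeSpectrum.asIdeal x : Ideal (AddMonoidAlgebra k S)).height = 1 := h1
    rw [hbot, Ideal.height_bot] at h2
    exact zero_ne_one h2
  obtain ⟨g, hg, hg0⟩ := Submodule.exists_mem_ne_zero_of_ne_bot hne
  obtain ⟨s, hs⟩ : ∃ s, g.coeff s ≠ 0 := by
    by_contra! H
    exact hg0 (AddMonoidAlgebra.coeff_eq_zero.1 (Finsupp.ext H))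
  have h1 := (mem_invariantPoints_iff k x).1 hinv g hg s
  rw [single_mem_iff k s hs] at h1
  exact h.eq_edgePoint_of_single_mem k hx h1

/-- The invariant prime divisors of `Spec k[S]`. -/
theorem edgeDivisor_bijective : Function.Bijective
    (fun i => ⟨h.edgePoint k i, (h.ord_edgePoint k i).1, h.edgePoint_mem_invariantPoints k i⟩ :
      ι → AffinePrimeDivisor k S) :=
  ⟨fun _ _ hij => h.edgePoint_injective k (congrArg Subtype.val hij), fun ⟨_, hx, hinv⟩ =>
    (h.eq_edgePoint_of_mem_invariantPoints k hx hinv).imp fun _ hi => Subtype.ext hi.symm⟩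

end EdgePoint

end IsCutOutBy

/-! ### Rational functions on `Spec k[S]` coming from the torus -/

section Torus

variable {M : Type v} [AddCommGroup M] (k : Type u) [Field k] (S : AddSubmonoid M)

/-- The inclusion of the torus `Spec k[M]` in `Spec k[S]`. -/
noncomputable abbrev torusMap : Spec (coordRing k (⊤ : AddSubmonoid M)) ⟶ Spec (coordRing k S) :=
  Spec.map (CommRingCat.ofHom (coordMap k (le_top : S ≤ ⊤)))

variable [Module.Free ℤ M] [IsOpenImmersion (torusMap k S)]

/-- The embedding of `k[M]` into the function field of `Spec k[S]`. -/
noncomputable def torusHom :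
    AddMonoidAlgebra k (⊤ : AddSubmonoid M) →+* (Spec (coordRing k S)).functionField :=
  (RingEquiv.ofBijective _ (functionFieldHom_bijective (torusMap k S))).symm.toRingHom.comp
    (toFunctionField (coordRing k (⊤ : AddSubmonoid M)))

variable {S} in
theorem functionFieldHom_torusHom (z : AddMonoidAlgebra k (⊤ : AddSubmonoid M)) :
    functionFieldHom (torusMap k S) (torusHom k S z) =
      toFunctionField (coordRing k (⊤ : AddSubmonoid M)) z :=
  (RingEquiv.ofBijective _ (functionFieldHom_bijective (torusMap k S))).apply_symm_apply _

theorem torusHom_coordMap (r : AddMonoidAlgebra k S) :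
    torusHom k S (coordMap k le_top r) = toFunctionField (coordRing k S) r := by
  apply (functionFieldHom_bijective (torusMap k S)).1
  rw [functionFieldHom_torusHom]
  exact (functionFieldHom_toFunctionField (CommRingCat.ofHom (coordMap k (le_top : S ≤ ⊤))) r).symm

theorem torusHom_injective : Function.Injective (torusHom k S) := fun z w h =>
  toFunctionField_injective (R := coordRing k (⊤ : AddSubmonoid M)) <| by
    rw [← functionFieldHom_torusHom k (S := S), h, functionFieldHom_torusHom]

variable {S} in
theorem torusHom_ne_zero {z : AddMonoidAlgebra k (⊤ : AddSubmonoid M)} (hz : z ≠ 0) :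
    torusHom k S z ≠ 0 :=
  (map_ne_zero_iff _ (torusHom_injective k S)).2 hz

variable {S} in
theorem ord_torusHom_mul [AddMonoid.FG S] {z w : AddMonoidAlgebra k (⊤ : AddSubmonoid M)}
    (hz : z ≠ 0) (hw : w ≠ 0) (x : Spec (coordRing k S)) :
    Scheme.ord (torusHom k S (z * w)) x =
      Scheme.ord (torusHom k S z) x + Scheme.ord (torusHom k S w) x := by
  rw [map_mul, Scheme.ord_mul (torusHom_ne_zero k hz) (torusHom_ne_zero k hw)]

end Torus

/-! ### Invariant Cartier divisors are given by characters -/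

namespace IsCutOutBy

variable {M : Type v} [AddCommGroup M] [Module.Free ℤ M] {ι : Type*} [Finite ι]
  {S : AddSubmonoid M} [AddMonoid.FG S] {v : ι → M →+ ℤ} (h : IsCutOutBy S v) (k : Type u) [Field k]
  [IsOpenImmersion (torusMap k S)]

/-- Multiplying `z` by a monomial from `k[S]` moves it into `k[S]` and shifts both sides by the same
amount. -/
theorem ord_torusHom (i : ι) {z : AddMonoidAlgebra k (⊤ : AddSubmonoid M)}
    {u : (⊤ : AddSubmonoid M)} (hu : z.coeff u ≠ 0) (hmin : ∀ t, z.coeff t ≠ 0 → v i u ≤ v i t) :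
    Scheme.ord (torusHom k S z) (h.edgePoint k i) = v i u := by
  obtain ⟨w, hw⟩ := h.top_eq_localization
  obtain ⟨n, r, hr⟩ := exists_mul_single_eq_coordMap k le_top w hw z
  have hz : z ≠ 0 := by rintro rfl; exact hu rfl
  have h1 := ord_torusHom_mul k hz (w := AddMonoidAlgebra.single
    (n • AddSubmonoid.inclusion (le_top : S ≤ ⊤) w) 1) (by simp) (h.edgePoint k i)
  have hcoeff (t : (⊤ : AddSubmonoid M)) : (coordMap k le_top r).coeff
      (t + n • AddSubmonoid.inclusion (le_top : S ≤ ⊤) w) = z.coeff t := by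
    rw [← hr, coeff_mul_single, mul_one]
  have huS : ((u + n • AddSubmonoid.inclusion (le_top : S ≤ ⊤) w : (⊤ : AddSubmonoid M)) : M) ∈
      S := by
    by_contra hnot
    exact hu (by rw [← hcoeff, coeff_coordMap_of_notMem k le_top r _ hnot])
  have h2 := (h.ord_edgePoint k i).2 r ⟨_, huS⟩
    (by rw [← coeff_coordMap k le_top]; exact (hcoeff u).trans_ne hu) fun t ht => by
      have h3 : (coordMap k le_top r).coeff (AddSubmonoid.inclusion (le_top : S ≤ ⊤) t) ≠ 0 := by
        rwa [coeff_coordMap]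
      have h4 := hcoeff ⟨t - n • w, trivial⟩
      have h5 := hmin ⟨t - n • w, trivial⟩ (by
        rw [← h4]
        convert h3
        ext
        simp)
      simp only [map_sub, map_nsmul] at h5
      simp only [AddSubmonoid.coe_add, AddSubmonoidClass.coe_nsmul, AddSubmonoid.coe_inclusion,
        map_add, map_nsmul]
      linarith
  have h6 := h.ord_single_edgePoint k i (n • w)
  rw [← torusHom_coordMap, coordMap_single, map_nsmul] at h6
  rw [hr, torusHom_coordMap, h2, h6] at h1
  simp only [AddSubmonoid.coe_add, AddSubmonoidClass.coe_nsmul, AddSubmonoid.coe_inclusion,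
    map_add, map_nsmul] at h1
  linarith

theorem ord_torusHom_le (i : ι) {z : AddMonoidAlgebra k (⊤ : AddSubmonoid M)}
    {u : (⊤ : AddSubmonoid M)} (hu : z.coeff u ≠ 0) :
    Scheme.ord (torusHom k S z) (h.edgePoint k i) ≤ v i u := by
  obtain ⟨w, hw, hmin⟩ := Finset.exists_min_image z.coeff.support (fun t => v i t)
    ⟨u, Finsupp.mem_support_iff.2 hu⟩
  rw [h.ord_torusHom k i (Finsupp.mem_support_iff.1 hw) fun t ht =>
    hmin t (Finsupp.mem_support_iff.2 ht)]
  exact hmin u (Finsupp.mem_support_iff.2 hu)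

/-- The orders of `z` at all invariant prime divisors are those of one character. -/
def IsMonomialAtEdges (z : AddMonoidAlgebra k (⊤ : AddSubmonoid M)) : Prop :=
  ∃ u : M, ∀ i, Scheme.ord (torusHom k S z) (h.edgePoint k i) = v i u

/-- `r` has an invertible exponent `s`, where all `v i` vanish, so `r` has order `0` at every edge.
Write `s = u + w` with `u` an exponent of `z` and `w` one of `b`. The orders of `z` and `b` at edge
`i` are at most `v i u` and `v i w`, while both pairs sum to `0`; so equality holds, with the same
`u` for all `i`. -/
theorem isMonomialAtEdges_of_mul {z b : AddMonoidAlgebra k (⊤ : AddSubmonoid M)}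
    {r : AddMonoidAlgebra k S} (hr : z * b = coordMap k le_top r)
    (hr0 : r ∉ (PrimeSpectrum.asIdeal (orbitPoint k S) : Ideal (AddMonoidAlgebra k S))) :
    h.IsMonomialAtEdges k z := by
  classical
  rw [mem_orbitPoint_iff] at hr0
  push Not at hr0
  obtain ⟨s, hs, hrs⟩ := hr0
  have hs0 (i) : v i s = 0 := by
    have h1 := (h.mem_iff _).1 s.2 i
    have h2 := (h.mem_iff _).1 hs i
    rw [map_neg] at h2
    omega
  have hzb : (z * b).coeff (AddSubmonoid.inclusion le_top s) ≠ 0 := by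
    rwa [hr, coeff_coordMap]
  have hzb0 : z * b ≠ 0 := by
    intro h0
    rw [h0] at hzb
    exact hzb rfl
  obtain ⟨u, hu, w, hw, huw⟩ := Finset.mem_add.1
    (AddMonoidAlgebra.support_coeff_mul_subset _ _ (Finsupp.mem_support_iff.2 hzb))
  refine ⟨u, fun i => ?_⟩
  have h1 := h.ord_torusHom_le k i (Finsupp.mem_support_iff.1 hu)
  have h2 := h.ord_torusHom_le k i (Finsupp.mem_support_iff.1 hw)
  have h3 := ord_torusHom_mul k (left_ne_zero_of_mul hzb0) (right_ne_zero_of_mul hzb0)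
    (h.edgePoint k i)
  rw [hr, torusHom_coordMap, (h.ord_edgePoint k i).2 r s hrs fun t _ => by
    rw [hs0]; exact (h.mem_iff _).1 t.2 i, hs0] at h3
  have h4 : v i u + v i w = 0 := by
    rw [← map_add, ← hs0 i]
    exact congrArg (fun t : (⊤ : AddSubmonoid M) => v i t) huw
  omega

omit [Finite ι] in
theorem IsMonomialAtEdges.mul {z w : AddMonoidAlgebra k (⊤ : AddSubmonoid M)} (hz0 : z ≠ 0)
    (hw0 : w ≠ 0) (hz : h.IsMonomialAtEdges k z) (hw : h.IsMonomialAtEdges k w) :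
    h.IsMonomialAtEdges k (z * w) := by
  obtain ⟨u, hu⟩ := hz
  obtain ⟨t, ht⟩ := hw
  exact ⟨u + t, fun i => by rw [ord_torusHom_mul k hz0 hw0, hu, ht, map_add]⟩

theorem isMonomialAtEdges_of_forall_prime [Module.Finite ℤ M]
    {z : AddMonoidAlgebra k (⊤ : AddSubmonoid M)} (hz : z ≠ 0)
    (H : ∀ π, Prime π → π ∣ z → h.IsMonomialAtEdges k π) : h.IsMonomialAtEdges k z := by
  have := uniqueFactorizationMonoid_top M k
  induction z using UniqueFactorizationMonoid.induction_on_prime with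
  | h₁ => exact absurd rfl hz
  | h₂ z hzu =>
    obtain ⟨b, hb⟩ := hzu.exists_right_inv
    -- A unit divides `1`, which lies outside the orbit prime.
    refine h.isMonomialAtEdges_of_mul k (r := 1) (hb.trans (map_one _).symm) fun h1 => ?_
    exact (orbitPoint k S).2.ne_top ((Ideal.eq_top_iff_one _).2 h1)
  | h₃ z π hz0 hπ ih =>
    exact IsMonomialAtEdges.mul h k hπ.ne_zero hz0 (H π hπ (dvd_mul_right _ _))
      (ih hz0 fun ρ hρ hdvd => H ρ hρ (hdvd.mul_left _))

omit [IsOpenImmersion (torusMap k S)] in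
include h in
-- An invariant point of codimension one contains a monomial, but monomials are units on the torus.
theorem torusMap_notMem_invariantPoints {y : Spec (coordRing k (⊤ : AddSubmonoid M))}
    (hy : Order.coheight (torusMap k S y) = 1) :
    torusMap k S y ∉ Toric.invariantPoints k S := by
  intro hinv
  obtain ⟨i, hi⟩ := h.eq_edgePoint_of_mem_invariantPoints k hy hinv
  obtain ⟨a, ha, ha1⟩ := h.exists_mem_eq_one i
  have h1 := (h.single_mem_edgePoint_iff k i ⟨a, ha⟩).2 (by rw [ha1]; exact one_ne_zero)
  rw [← hi] at h1
  have h2 : coordMap k le_top (AddMonoidAlgebra.single ⟨a, ha⟩ 1) ∈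
      (PrimeSpectrum.asIdeal y : Ideal (AddMonoidAlgebra k (⊤ : AddSubmonoid M))) := h1
  rw [coordMap_single] at h2
  have h3 := Ideal.mul_mem_right (AddMonoidAlgebra.single ⟨-a, trivial⟩ 1) _ h2
  rw [AddMonoidAlgebra.single_mul_single, mul_one] at h3
  refine y.2.ne_top ((Ideal.eq_top_iff_one _).2 ?_)
  convert h3
  rw [AddMonoidAlgebra.one_def]
  congr 1
  ext
  simp

theorem exists_coeff_eq_of_mem_cartierDivisors [Module.Finite ℤ M] {D : AffineWeilDivisor k S}
    (hD : D ∈ cartierDivisors _ (Toric.invariantPoints k S)) :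
    ∃ u : M, ∀ i, D.coeff (h.edgePoint k i) = v i u := by
  -- A neighbourhood of the orbit point contains every edge point, so this one `f` determines all
  -- coefficients of `D`.
  obtain ⟨U, hU, f, hf, hDf⟩ := hD (orbitPoint k S)
  have hufd : UniqueFactorizationMonoid (coordRing k (⊤ : AddSubmonoid M)) :=
    uniqueFactorizationMonoid_top M k
  have hfg : AddMonoid.FG (⊤ : AddSubmonoid M) := by
    obtain ⟨w, hw⟩ := h.top_eq_localization
    exact fg_of_eq_localization hw
  obtain ⟨a, b, ha, hb, hab, hfab⟩ := exists_isRelPrime_fraction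
    ((map_ne_zero (functionFieldHom (torusMap k S))).2 hf)
  have hfab' : f * torusHom k S b = torusHom k S a := by
    apply (functionFieldHom_bijective (torusMap k S)).1
    rw [map_mul, functionFieldHom_torusHom, functionFieldHom_torusHom, hfab]
  have hord (x : Spec (coordRing k S)) :
      Scheme.ord f x + Scheme.ord (torusHom k S b) x = Scheme.ord (torusHom k S a) x := by
    rw [← hfab', Scheme.ord_mul hf (torusHom_ne_zero k hb)]
  have key (π : AddMonoidAlgebra k (⊤ : AddSubmonoid M)) (hπ : Prime π) (hπab : π ∣ a ∨ π ∣ b) :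
      h.IsMonomialAtEdges k π := by
    let y : Spec (coordRing k (⊤ : AddSubmonoid M)) :=
      (⟨Ideal.span {π}, (Ideal.span_singleton_prime hπ.ne_zero).2 hπ⟩ :
        PrimeSpectrum (AddMonoidAlgebra k (⊤ : AddSubmonoid M)))
    have hco : Order.coheight (torusMap k S y) = 1 :=
      (coheight_eq_of_isOpenImmersion _).trans (ord_uniformizer hπ y rfl).1
    -- If the hypersurface of `π` passes through the orbit point, then `f` has order `0` along it,
    -- since `D` has only invariant components. This is impossible, as `π` divides exactly one of
    -- `a` and `b`.
    by_cases hle : torusMap k S y ⤳ orbitPoint k S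
    · have hU' : torusMap k S y ∈ U := hle.mem_open U.isOpen hU
      have h1 := hDf _ hU' hco
      rw [WeilDivisor.coeff, dif_neg fun hx => torusMap_notMem_invariantPoints h k hco hx.2] at h1
      have h2 := hord (torusMap k S y)
      rw [← h1, zero_add, ← ord_functionFieldHom, ← ord_functionFieldHom,
        functionFieldHom_torusHom, functionFieldHom_torusHom] at h2
      have hnot : ∀ c : coordRing k (⊤ : AddSubmonoid M), ¬ π ∣ c →
          Scheme.ord (toFunctionField _ c) y = 0 := fun c hc =>
        ord_toFunctionField_of_notMem y (by rwa [← Ideal.mem_span_singleton] at hc)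
      rcases hπab with hπa | hπb
      · have h3 := ord_pos_of_dvd hπ y rfl ha hπa
        rw [← h2, hnot b fun hπb => hπ.not_isUnit (hab hπa hπb)] at h3
        exact absurd h3 (lt_irrefl _)
      · have h3 := ord_pos_of_dvd hπ y rfl hb hπb
        rw [h2, hnot a fun hπa => hπ.not_isUnit (hab hπa hπb)] at h3
        exact absurd h3 (lt_irrefl _)
    -- Otherwise some `r ∈ k[S]` is divisible by `π` in `k[M]` and lies outside the orbit prime.
    · have hle := mt (PrimeSpectrum.le_iff_specializes _ _).1 hle
      obtain ⟨r, hr, hr0⟩ := Set.not_subset.1 hle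
      obtain ⟨c, hc⟩ := Ideal.mem_span_singleton.1
        (show coordMap k (le_top : S ≤ ⊤) r ∈ Ideal.span {π} from hr)
      exact h.isMonomialAtEdges_of_mul k hc.symm hr0
  obtain ⟨u, hu⟩ := h.isMonomialAtEdges_of_forall_prime k ha fun π hπ hd => key π hπ (.inl hd)
  obtain ⟨w, hw⟩ := h.isMonomialAtEdges_of_forall_prime k hb fun π hπ hd => key π hπ (.inr hd)
  refine ⟨u - w, fun i => ?_⟩
  have hi : h.edgePoint k i ∈ U :=
    (specializes_orbitPoint k (h.edgePoint_mem_invariantPoints k i)).mem_open U.isOpen hU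
  have h1 := hord (h.edgePoint k i)
  rw [hDf _ hi (h.ord_edgePoint k i).1, map_sub, ← hu, ← hw, ← h1, add_sub_cancel_right]

theorem mem_cartierDivisors_of_coeff_eq {D : AffineWeilDivisor k S} {u : M}
    (hD : ∀ i, D.coeff (h.edgePoint k i) = v i u) :
    D ∈ cartierDivisors _ (Toric.invariantPoints k S) := by
  classical
  refine fun _ => ⟨⊤, trivial, torusHom k S (AddMonoidAlgebra.single ⟨u, trivial⟩ 1),
    torusHom_ne_zero k (by simp), fun x _ hx => ?_⟩
  -- A codimension-one point containing a monomial is an edge point. At any other one `t^u` has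
  -- order `0`, being a quotient of two monomials of `k[S]` outside the prime.
  by_cases hmono : ∃ s : S, AddMonoidAlgebra.single s 1 ∈
      (PrimeSpectrum.asIdeal x : Ideal (AddMonoidAlgebra k S))
  · obtain ⟨s, hs⟩ := hmono
    obtain ⟨i, rfl⟩ := h.eq_edgePoint_of_single_mem k hx hs
    rw [hD, h.ord_torusHom k i (u := ⟨u, trivial⟩) (by simp)]
    intro t ht
    rw [AddMonoidAlgebra.coeff_single, Finsupp.single_apply] at ht
    split_ifs at ht with hut
    · rw [← hut]
    · exact absurd rfl ht
  · push Not at hmono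
    rw [WeilDivisor.coeff, dif_neg]
    · obtain ⟨w, hw, hpos⟩ := h.exists_forall_pos
      obtain ⟨n, hn⟩ := h.exists_nsmul_add_mem u hpos
      have h1 := ord_torusHom_mul k (z := AddMonoidAlgebra.single ⟨u, trivial⟩ 1)
        (w := AddMonoidAlgebra.single (AddSubmonoid.inclusion (le_top : S ≤ ⊤) (n • ⟨w, hw⟩)) 1)
        (by simp) (by simp) x
      have h2 : (⟨u, trivial⟩ : (⊤ : AddSubmonoid M)) +
          AddSubmonoid.inclusion (le_top : S ≤ ⊤) (n • ⟨w, hw⟩) =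
            AddSubmonoid.inclusion le_top ⟨_, hn⟩ := rfl
      rw [AddMonoidAlgebra.single_mul_single, mul_one, h2, ← coordMap_single, ← coordMap_single,
        torusHom_coordMap, torusHom_coordMap,
        ord_toFunctionField_of_notMem x (hmono _), ord_toFunctionField_of_notMem x (hmono _)] at h1
      omega
    · rintro ⟨-, hinv⟩
      obtain ⟨i, rfl⟩ := h.eq_edgePoint_of_mem_invariantPoints k hx hinv
      obtain ⟨a, ha, ha1⟩ := h.exists_mem_eq_one i
      exact hmono ⟨a, ha⟩ ((h.single_mem_edgePoint_iff k i _).2 (by rw [ha1]; exact one_ne_zero))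

end IsCutOutBy

/-! ### The class group as a cokernel -/

namespace IsCutOutBy

variable {M : Type v} [AddCommGroup M] [Module.Free ℤ M] [Module.Finite ℤ M] {ι : Type*} [Finite ι]
  {S : AddSubmonoid M} [AddMonoid.FG S] {v : ι → M →+ ℤ} (h : IsCutOutBy S v) (k : Type u) [Field k]
include h

theorem natCard_localClassGroup :
    Nat.card (LocalClassGroup k S) = (AddMonoidHom.pi v).range.index := by
  obtain ⟨w, hw⟩ := h.top_eq_localization
  have : IsOpenImmersion (torusMap k S) := isOpenImmersion_coordMap k le_top w hw
  let e := Equiv.ofBijective _ (h.edgeDivisor_bijective k)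
  have : Finite (AffinePrimeDivisor k S) := .of_equiv _ e
  let Φ : AffineWeilDivisor k S →+ (ι → ℤ) := AddMonoidHom.pi fun i => Finsupp.applyAddHom (e i)
  have hΦ : Function.Surjective Φ := fun c => by
    refine ⟨Finsupp.equivFunOnFinite.symm fun p => c (e.symm p), funext fun i => ?_⟩
    exact congrArg c (e.symm_apply_apply i)
  have hcoeff : ∀ (D : AffineWeilDivisor k S) i, D.coeff (h.edgePoint k i) = Φ D i := fun D i =>
    dif_pos (e i).2
  have hcartier : cartierDivisors _ (invariantPoints k S) = (AddMonoidHom.pi v).range.comap Φ := by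
    ext D
    constructor
    · intro hD
      obtain ⟨u, hu⟩ := h.exists_coeff_eq_of_mem_cartierDivisors k hD
      exact ⟨u, funext fun i => ((hcoeff D i).symm.trans (hu i)).symm⟩
    · rintro ⟨u, hu⟩
      exact h.mem_cartierDivisors_of_coeff_eq k (u := u)
        fun i => (hcoeff D i).trans (congrFun hu i).symm
  rw [← AddSubgroup.index_comap_of_surjective _ hΦ, ← hcartier]
  rfl

end IsCutOutBy

/-! ### Indices of lattices as determinants -/

section Lattice

variable {N : Type v} [AddCommGroup N]

/-- Evaluation of linear forms at a vector. -/
def evalAt (w : N) : Module.Dual ℤ N →+ ℤ where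
  toFun u := u w
  map_zero' := rfl
  map_add' _ _ := rfl

theorem evalAt_apply (w : N) (u : Module.Dual ℤ N) : evalAt w u = u w := rfl

/-- Let `A` have the coordinates of the `w i` as rows. Evaluation at the `w i` is multiplication by
`A` in dual coordinates, while the `w i` span the image of the transpose; both indices are `|det
A|`. -/
theorem index_range_evalAt {ι : Type*} [Fintype ι] (c : Module.Basis ι ℤ N) {w : ι → N}
    (hw : LinearIndependent ℤ w) :
    (AddMonoidHom.pi fun i => evalAt (w i)).range.index = (AddSubgroup.closure (Set.range w)).index ∧
      (AddMonoidHom.pi fun i => evalAt (w i)).range.index ≠ 0 := by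
  classical
  let A : Matrix ι ι ℤ := Matrix.of fun i j => c.repr (w i) j
  have hA : A.det ≠ 0 := by
    intro h0
    obtain ⟨x, hx, hxA⟩ := Matrix.exists_vecMul_eq_zero_iff.2 h0
    refine hx (funext (Fintype.linearIndependent_iff.1 hw x (c.repr.injective ?_)))
    ext j
    simpa [Matrix.vecMul, dotProduct, A] using congrFun hxA j
  have hinj : Function.Injective A.mulVecLin := by
    rw [← LinearMap.ker_eq_bot, LinearMap.ker_eq_bot']
    intro x hx
    by_contra hx0
    exact hA (Matrix.exists_mulVec_eq_zero_iff.1 ⟨x, hx0, hx⟩)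
  have hrange : (AddMonoidHom.pi fun i => evalAt (w i)).range = A.mulVecLin.range.toAddSubgroup := by
    ext y
    constructor
    · rintro ⟨u, rfl⟩
      refine ⟨fun j => u (c j), funext fun i => ?_⟩
      change ∑ j, c.repr (w i) j * u (c j) = u (w i)
      rw [← congrArg u (c.sum_repr (w i)), map_sum]
      exact Finset.sum_congr rfl fun j _ => (map_smul u _ _).symm
    · rintro ⟨x, rfl⟩
      refine ⟨c.constr ℤ x, funext fun i => ?_⟩
      change c.constr ℤ x (w i) = ∑ j, c.repr (w i) j * x j
      simp [Module.Basis.constr_apply_fintype, mul_comm]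
  have h1 : (AddMonoidHom.pi fun i => evalAt (w i)).range.index = A.det.natAbs := by
    rw [hrange, AddSubgroup.index_eq_natAbs_det (Pi.basisFun ℤ ι) _
      ((Pi.basisFun ℤ ι).map (LinearEquiv.ofInjective _ hinj)), Module.Basis.det_apply]
    congr 2
    ext i j
    change A.mulVecLin (Pi.single j 1) i = _
    simp
  have h2 : (AddSubgroup.closure (Set.range w)).index = A.det.natAbs := by
    rw [← Submodule.span_int_eq_addSubgroupClosure, AddSubgroup.index_eq_natAbs_det c _
      (Module.Basis.span hw), Module.Basis.det_apply, ← Matrix.det_transpose]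
    congr 2
    ext i j
    exact congrArg (fun x : Submodule.span ℤ (Set.range w) => c.repr x j) (Module.Basis.span_apply hw i)
  exact ⟨h1.trans h2.symm, h1.trans_ne (Int.natAbs_ne_zero.2 hA)⟩

end Lattice

/-! ### Simplicial cones over `ℝ` -/

section Cones

variable {E : Type*} [AddCommGroup E] [Module ℝ E]

theorem exists_coordinates_hull {ι : Type*} [Fintype ι] [DecidableEq ι] {e : ι → E}
    (he : LinearIndependent ℝ e) :
    ∃ g : E →ₗ[ℝ] ι → ℝ, (∀ i, g (e i) = Pi.single i 1) ∧
      ∀ x ∈ PointedCone.hull ℝ (Set.range e), 0 ≤ g x ∧ ∑ i, g x i • e i = x := by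
  obtain ⟨g, hg⟩ := (Fintype.linearCombination ℝ e).exists_leftInverse_of_injective
    (LinearMap.ker_eq_bot.2 he.fintypeLinearCombination_injective)
  have hge : ∀ i, g (e i) = Pi.single i 1 := fun i => by
    have := LinearMap.congr_fun hg (Pi.single i 1)
    simpa [Fintype.linearCombination_apply_single] using this
  refine ⟨g, hge, fun x hx => ?_⟩
  induction hx using Submodule.span_induction with
  | mem x hx =>
    obtain ⟨i, rfl⟩ := hx
    rw [hge]
    exact ⟨Pi.single_nonneg.2 zero_le_one, by simp [Pi.single_apply]⟩
  | zero => simp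
  | add x y _ _ hx hy =>
    refine ⟨by rw [map_add]; exact add_nonneg hx.1 hy.1, ?_⟩
    simp only [map_add, Pi.add_apply, add_smul, Finset.sum_add_distrib, hx.2, hy.2]
  | smul a x _ hx =>
    have h1 : g (a • x) = (a : ℝ) • g x := map_smul g (a : ℝ) x
    refine ⟨by rw [h1]; exact smul_nonneg a.2 hx.1, ?_⟩
    simp only [h1, Pi.smul_apply, smul_assoc, ← Finset.smul_sum, hx.2]
    rfl

theorem mem_hull_singleton {x y : E} :
    y ∈ PointedCone.hull ℝ {x} ↔ ∃ t : ℝ, 0 ≤ t ∧ t • x = y :=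
  Submodule.mem_span_singleton.trans
    ⟨fun ⟨a, h⟩ => ⟨a, a.2, h⟩, fun ⟨a, ha, h⟩ => ⟨⟨a, ha⟩, h⟩⟩

/-- Coordinates on the cone are nonnegative. If `a • x + y` has zero `j`-th coordinate for `j ≠ i`,
so has `x`. -/
theorem isFaceOf_hull_singleton {ι : Type*} [Fintype ι] {e : ι → E}
    (he : LinearIndependent ℝ e) (i : ι) :
    (PointedCone.hull ℝ {e i}).IsFaceOf (PointedCone.hull ℝ (Set.range e)) := by
  classical
  obtain ⟨g, hge, hg⟩ := exists_coordinates_hull he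
  refine ⟨Submodule.span_mono (Set.singleton_subset_iff.2 ⟨i, rfl⟩), ?_⟩
  intro x y a hx hy ha hxy
  obtain ⟨t, -, ht⟩ := mem_hull_singleton.1 hxy
  refine mem_hull_singleton.2 ⟨g x i, (hg x hx).1 i, ?_⟩
  conv_rhs => rw [← (hg x hx).2]
  rw [Finset.sum_eq_single i (fun j _ hji => ?_) (by simp)]
  have h1 := congrFun (congrArg g ht) j
  have h2 : 0 ≤ g x j := (hg x hx).1 j
  have h3 : 0 ≤ g y j := (hg y hy).1 j
  simp only [map_smul, map_add, hge, Pi.smul_apply, Pi.add_apply, Pi.single_eq_of_ne hji,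
    smul_eq_mul, mul_zero] at h1
  have h4 : g x j = 0 := by
    by_contra h0
    have := mul_pos ha (lt_of_le_of_ne h2 (Ne.symm h0))
    linarith
  rw [h4, zero_smul]

/-- An element of a linearly independent set is a multiple of one of any given generators of the
cone spanned by the set. -/
theorem exists_smul_mem_of_hull_eq {ι : Type*} [Fintype ι] {e : ι → E}
    (he : LinearIndependent ℝ e) {V : Set E}
    (hV : PointedCone.hull ℝ (Set.range e) = PointedCone.hull ℝ V) (i : ι) :
    ∃ r : ℝ, 0 < r ∧ r • e i ∈ V := by
  classical
  obtain ⟨g, hge, hg⟩ := exists_coordinates_hull he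
  have hi : e i ∈ PointedCone.hull ℝ V := hV ▸ Submodule.subset_span ⟨i, rfl⟩
  obtain ⟨c, hcV, hc, hsum⟩ := PointedCone.mem_hull_set.1 hi
  have hcone : ∀ y ∈ c.support, y ∈ PointedCone.hull ℝ (Set.range e) := fun y hy =>
    hV ▸ Submodule.subset_span (hcV hy)
  have hsum' : ∀ j, ∑ y ∈ c.support, c y * g y j = Pi.single (M := fun _ => ℝ) i 1 j := fun j => by
    have := congrFun (congrArg g hsum) j
    rw [hge, Finsupp.sum, map_sum, Finset.sum_apply] at this
    simpa using this
  have h1 : ∑ y ∈ c.support, c y * g y i ≠ 0 := by simp [hsum']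
  -- Some generator in the expression of `e i` has nonzero `i`-th coordinate. The other coordinates
  -- in that sum are nonnegative and add up to `0`, so this generator lies on the ray of `e i`.
  obtain ⟨y, hy, hy0⟩ := Finset.exists_ne_zero_of_sum_ne_zero h1
  have hyi : 0 < g y i :=
    lt_of_le_of_ne ((hg y (hcone y hy)).1 i) (right_ne_zero_of_mul hy0).symm
  refine ⟨g y i, hyi, ?_⟩
  convert hcV hy
  conv_rhs => rw [← (hg y (hcone y hy)).2]
  rw [Finset.sum_eq_single i (fun j _ hji => ?_) (by simp)]
  have h2 := hsum' j
  rw [Pi.single_eq_of_ne hji, Finset.sum_eq_zero_iff_of_nonneg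
    fun z hz => mul_nonneg (hc z) ((hg z (hcone z hz)).1 j)] at h2
  rw [(mul_eq_zero.1 (h2 y hy)).resolve_left (left_ne_zero_of_mul hy0), zero_smul]

end Cones

/-! ### Primitive vectors -/

section Lattice

variable {N : Type v} [AddCommGroup N] [Module.Free ℤ N] [Module.Finite ℤ N]

omit [Module.Finite ℤ N] in
theorem one_tmul_injective : Function.Injective fun v : N => (1 : ℝ) ⊗ₜ[ℤ] v :=
  Module.Flat.tensorProduct_mk_injective (R := ℤ) (S := ℝ) (M := N)

/-- A nonzero vector of a lattice is a positive multiple of a unimodular one. -/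
theorem exists_nsmul_eq_of_ne_zero {v : N} (hv : v ≠ 0) :
    ∃ (d : ℕ) (w : N) (u : Module.Dual ℤ N), 0 < d ∧ d • w = v ∧ u w = 1 := by
  let b := Module.Free.chooseBasis ℤ N
  -- The values at `v` of all integral forms make up an ideal; its generator is the gcd of the
  -- coordinates of `v`, and it is attained by a form.
  obtain ⟨g, hg : LinearMap.range (Module.Dual.eval ℤ N v) = Ideal.span {g}⟩ :=
    IsPrincipalIdealRing.principal (LinearMap.range (Module.Dual.eval ℤ N v))
  rw [← Int.span_natAbs] at hg
  set d := g.natAbs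
  obtain ⟨u, hu⟩ : ∃ u : Module.Dual ℤ N, u v = d := by
    have : (d : ℤ) ∈ LinearMap.range (Module.Dual.eval ℤ N v) := hg ▸ Ideal.mem_span_singleton_self _
    exact this
  have hdvd : ∀ i, ∃ a : ℤ, b.repr v i = d * a := fun i => by
    have : b.coord i v ∈ LinearMap.range (Module.Dual.eval ℤ N v) := ⟨b.coord i, rfl⟩
    rw [hg] at this
    exact Ideal.mem_span_singleton.1 this
  choose a ha using hdvd
  have hw : d • ∑ i, a i • b i = v := by
    conv_rhs => rw [← b.sum_repr v]
    simp only [ha, Finset.smul_sum, mul_smul, Nat.cast_smul_eq_nsmul]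
  have hd : d ≠ 0 := by
    rintro h0
    rw [h0, zero_smul] at hw
    exact hv hw.symm
  refine ⟨d, _, u, Nat.pos_of_ne_zero hd, hw, ?_⟩
  have h1 := congrArg u hw
  rw [map_nsmul, hu, nsmul_eq_mul] at h1
  exact mul_left_cancel₀ (Nat.cast_ne_zero.2 hd) (h1.trans (mul_one _).symm)

omit [Module.Free ℤ N] [Module.Finite ℤ N] in
theorem eq_one_of_nsmul_eq {v w : N} {u : Module.Dual ℤ N} (hu : u w = 1) {n : ℕ}
    (h : n • v = w) : n = 1 := by
  have h1 := congrArg u h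
  rw [map_nsmul, hu, nsmul_eq_mul] at h1
  exact Nat.dvd_one.1 (Int.natCast_dvd_natCast.1 ⟨u v, by simpa using h1.symm⟩)

end Lattice

/-! ### Edges, span lattice and multiplicity of a simplicial cone -/

namespace RationalCone

variable {N : Type v} [AddCommGroup N] [Module.Free ℤ N] [Module.Finite ℤ N] (σ : RationalCone N)

/-- The real generators given by simpliciality are positive multiples of vectors of `N`, since
rational generators must occur on their rays. The forms `u i` certify that the `w i` are primitive.
-/
theorem exists_unimodular_generators (hσ : σ.cone.IsSimplicial) :
    ∃ (ι : Type v) (_ : Fintype ι) (w : ι → N) (u : ι → Module.Dual ℤ N),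
      LinearIndependent ℝ (fun i => (1 : ℝ) ⊗ₜ[ℤ] w i) ∧
      σ.cone = PointedCone.hull ℝ (Set.range fun i => (1 : ℝ) ⊗ₜ[ℤ] w i) ∧
      ∀ i, u i (w i) = 1 := by
  obtain ⟨s, hs, hli, hcone⟩ := hσ
  obtain ⟨V, hV⟩ := σ.rational
  have := hs.fintype
  have he : LinearIndependent ℝ ((↑) : s → ℝ ⊗[ℤ] N) := hli
  have key : ∀ x : s, ∃ (w : N) (u : Module.Dual ℤ N) (r : ℝ), 0 < r ∧
      (1 : ℝ) ⊗ₜ[ℤ] w = r • (x : ℝ ⊗[ℤ] N) ∧ u w = 1 := fun x => by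
    obtain ⟨r, hr, v, -, hv⟩ := exists_smul_mem_of_hull_eq he
      (V := (fun v : N => (1 : ℝ) ⊗ₜ[ℤ] v) '' V)
      (by rw [Subtype.range_coe, hcone, hV]) x
    have hv0 : v ≠ 0 := by
      rintro rfl
      simp only [TensorProduct.tmul_zero] at hv
      exact smul_ne_zero hr.ne' (he.ne_zero x) hv.symm
    obtain ⟨d, w, u, hd, rfl, hu⟩ := exists_nsmul_eq_of_ne_zero hv0
    have hd' : (0 : ℝ) < d := Nat.cast_pos.2 hd
    refine ⟨w, u, (d : ℝ)⁻¹ * r, mul_pos (inv_pos.2 hd') hr, ?_, hu⟩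
    rw [mul_smul, ← hv]
    beta_reduce
    rw [TensorProduct.tmul_smul, ← Nat.cast_smul_eq_nsmul ℝ,
      inv_smul_smul₀ hd'.ne']
  choose w u r hr hw hu using key
  refine ⟨s, inferInstance, w, u, ?_, ?_, hu⟩
  · have := he.units_smul fun x => Units.mk0 (r x) (hr x).ne'
    exact (funext hw : (fun x => (1 : ℝ) ⊗ₜ[ℤ] w x) = _) ▸ this
  · refine le_antisymm ?_ ?_
    · rw [← hcone]
      refine Submodule.span_le.2 fun x hx => ?_
      have h1 : x = (r ⟨x, hx⟩)⁻¹ • (1 : ℝ) ⊗ₜ[ℤ] w ⟨x, hx⟩ := by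
        rw [hw, inv_smul_smul₀ (hr _).ne']
      rw [h1]
      exact PointedCone.smul_mem _ (inv_nonneg.2 (hr _).le) (Submodule.subset_span ⟨_, rfl⟩)
    · refine Submodule.span_le.2 ?_
      rintro _ ⟨x, rfl⟩
      change (1 : ℝ) ⊗ₜ[ℤ] w x ∈ σ.cone
      rw [hw, ← hcone]
      exact PointedCone.smul_mem _ (hr _).le (Submodule.subset_span x.2)

variable {σ} {ι : Type*} [Fintype ι] {w : ι → N} {u : ι → Module.Dual ℤ N}

omit [Module.Finite ℤ N] in
theorem primitiveGenerators_eq_range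
    (hw : LinearIndependent ℝ fun i => (1 : ℝ) ⊗ₜ[ℤ] w i)
    (hcone : σ.cone = PointedCone.hull ℝ (Set.range fun i => (1 : ℝ) ⊗ₜ[ℤ] w i))
    (hu : ∀ i, u i (w i) = 1) : σ.primitiveGenerators = Set.range w := by
  classical
  refine Set.Subset.antisymm ?_ ?_
  · rintro v ⟨hv, hF⟩
    obtain ⟨g, -, hg⟩ := exists_coordinates_hull hw
    have hvσ : (1 : ℝ) ⊗ₜ[ℤ] v ∈ σ.cone := hF.le (Submodule.mem_span_singleton_self _)
    obtain ⟨hg0, hgs⟩ := hg _ (hcone ▸ hvσ)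
    obtain ⟨i, hi⟩ : ∃ i, 0 < g ((1 : ℝ) ⊗ₜ[ℤ] v) i := by
      by_contra! hneg
      have h0 : (1 : ℝ) ⊗ₜ[ℤ] v = 0 := by
        rw [← hgs]
        exact Finset.sum_eq_zero fun i _ => by rw [le_antisymm (hneg i) (hg0 i), zero_smul]
      have : v = 0 := one_tmul_injective (h0.trans (TensorProduct.tmul_zero _ _).symm)
      -- The primitivity condition excludes `v = 0`: it would force the multiplier `0` to be `1`.
      exact zero_ne_one (hv 0 0 (by rw [this, smul_zero]))
    -- `v` is a nonnegative combination of the `w j`; as its ray is a face, it contains each `w j`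
    -- occurring with positive coefficient.
    have hmem : (1 : ℝ) ⊗ₜ[ℤ] w i ∈ PointedCone.hull ℝ {(1 : ℝ) ⊗ₜ[ℤ] v} :=
      hF.mem_of_sum_smul_mem (f := fun i => (1 : ℝ) ⊗ₜ[ℤ] w i)
        (fun j => hcone ▸ Submodule.subset_span ⟨j, rfl⟩) hg0
        (by rw [hgs]; exact Submodule.mem_span_singleton_self _) i hi
    obtain ⟨t, ht, htw⟩ := mem_hull_singleton.1 hmem
    have h1 : t * (u i v : ℝ) = 1 := by
      have := congrArg (pairing (u i)) htw
      rw [map_smul, pairing_tmul, pairing_tmul, hu] at this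
      simpa using this
    have hpos : (0 : ℝ) < u i v := by
      by_contra hn
      linarith [mul_nonpos_of_nonneg_of_nonpos ht (not_lt.1 hn)]
    obtain ⟨n, hn⟩ := Int.eq_ofNat_of_zero_le (Int.cast_pos.1 hpos).le
    rw [hn, Int.cast_natCast] at h1
    have h2 : n • w i = v := one_tmul_injective <| by
      change (1 : ℝ) ⊗ₜ[ℤ] (n • w i) = _
      rw [TensorProduct.tmul_smul, ← Nat.cast_smul_eq_nsmul ℝ, ← htw, smul_smul, mul_comm, h1,
        one_smul]
    refine ⟨i, ?_⟩
    rw [← h2, hv n _ h2, one_smul]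
  · rintro _ ⟨i, rfl⟩
    refine ⟨fun n v h => eq_one_of_nsmul_eq (hu i) h, ?_⟩
    rw [hcone]
    exact isFaceOf_hull_singleton hw i

omit [Module.Free ℤ N] [Module.Finite ℤ N] [Fintype ι] in
theorem mem_spanLattice_iff
    (hcone : σ.cone = PointedCone.hull ℝ (Set.range fun i => (1 : ℝ) ⊗ₜ[ℤ] w i)) (v : N) :
    v ∈ σ.spanLattice ↔
      (1 : ℝ) ⊗ₜ[ℤ] v ∈ Submodule.span ℝ (Set.range fun i => (1 : ℝ) ⊗ₜ[ℤ] w i) := by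
  change _ ∈ Submodule.span ℝ _ ↔ _
  rw [hcone, show Submodule.span ℝ (PointedCone.hull ℝ (Set.range fun i => (1 : ℝ) ⊗ₜ[ℤ] w i) :
    Set (ℝ ⊗[ℤ] N)) = _ from Submodule.span_span_of_tower _ _ _]

instance free_spanLattice : Module.Free ℤ σ.spanLattice :=
  inferInstanceAs (Module.Free ℤ (AddSubgroup.toIntSubmodule σ.spanLattice))

/-- The rank is the number of edges: the `w' i` are independent, and a `ℤ`-basis of the span lattice
stays independent over `ℝ` inside the span of the `w i`. -/
theorem nonempty_basis_spanLattice
    (hw : LinearIndependent ℝ fun i => (1 : ℝ) ⊗ₜ[ℤ] w i)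
    (hcone : σ.cone = PointedCone.hull ℝ (Set.range fun i => (1 : ℝ) ⊗ₜ[ℤ] w i))
    {w' : ι → σ.spanLattice} (hw' : LinearIndependent ℤ w') :
    Nonempty (Module.Basis ι ℤ σ.spanLattice) := by
  have hfin : Module.Finite ℤ σ.spanLattice :=
    inferInstanceAs (Module.Finite ℤ (AddSubgroup.toIntSubmodule σ.spanLattice))
  let c := Module.finBasis ℤ σ.spanLattice
  have hc : LinearIndependent ℤ fun i => (c i : N) :=
    c.linearIndependent.map' σ.spanLattice.subtype.toIntLinearMap
      (LinearMap.ker_eq_bot.2 Subtype.val_injective)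
  have := Fintype.ofFinite (Set.range fun i => (1 : ℝ) ⊗ₜ[ℤ] w i)
  have hle := linearIndependent_le_span' _ (Module.Flat.linearIndependent_one_tmul (S := ℝ) hc)
    (Set.range fun i => (1 : ℝ) ⊗ₜ[ℤ] w i) (by
      rintro _ ⟨i, rfl⟩
      exact (mem_spanLattice_iff hcone _).1 (c i).2)
  have hcard : Fintype.card ι = Module.finrank ℤ σ.spanLattice :=
    le_antisymm hw'.fintype_card_le_finrank (by simpa [Set.card_range_of_injective hw.injective] using hle)
  exact ⟨c.reindex (Fintype.equivFinOfCardEq hcard).symm⟩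

omit [Module.Free ℤ N] in
/-- Linear forms on `N ∩ ℝσ` extend to `N`. -/
theorem exists_dual_extend (f : Module.Dual ℤ σ.spanLattice) :
    ∃ g : Module.Dual ℤ N, ∀ x : σ.spanLattice, g x = f x := by
  let L := AddSubgroup.toIntSubmodule σ.spanLattice
  -- `L` is cut out by a real subspace, hence saturated. The quotient is then free, and `L` is a
  -- direct summand.
  have htf : Module.IsTorsionFree ℤ (N ⧸ L) := by
    refine .of_smul_eq_zero fun n x hx => ?_
    obtain ⟨v, rfl⟩ := L.mkQ_surjective x
    refine or_iff_not_imp_left.2 fun hn => (Submodule.Quotient.mk_eq_zero L).2 ?_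
    have hnv : n • v ∈ σ.spanLattice := (Submodule.Quotient.mk_eq_zero L).1 hx
    change (1 : ℝ) ⊗ₜ[ℤ] (n • v) ∈ Submodule.span ℝ _ at hnv
    rw [TensorProduct.tmul_smul, ← Int.cast_smul_eq_zsmul ℝ,
      Submodule.smul_mem_iff _ (Int.cast_ne_zero.2 hn)] at hnv
    exact hnv
  have : Module.Free ℤ (N ⧸ L) := inferInstance
  obtain ⟨s, hs⟩ := Module.projective_lifting_property L.mkQ LinearMap.id L.mkQ_surjective
  have hmem : ∀ x, x - s (L.mkQ x) ∈ L := fun x => by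
    refine (Submodule.Quotient.mk_eq_zero L).1 ?_
    rw [Submodule.Quotient.mk_sub, sub_eq_zero]
    exact (LinearMap.congr_fun hs (L.mkQ x)).symm
  let r : N →ₗ[ℤ] L := (LinearMap.id - s ∘ₗ L.mkQ).codRestrict L hmem
  refine ⟨LinearMap.comp (M₂ := σ.spanLattice) f r, fun x => congrArg f (Subtype.ext ?_)⟩
  change (x : N) - s (L.mkQ x) = x
  rw [show L.mkQ x = 0 from (Submodule.Quotient.mk_eq_zero L).2 x.2, map_zero, sub_zero]

/-- Forms on `N ∩ ℝσ` extend to `N`, so evaluating forms on either lattice has the same image. This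
reduces a cone of any dimension to a full-dimensional one. -/
theorem index_range_evalAt_eq_multiplicity
    (hw : LinearIndependent ℝ fun i => (1 : ℝ) ⊗ₜ[ℤ] w i)
    (hcone : σ.cone = PointedCone.hull ℝ (Set.range fun i => (1 : ℝ) ⊗ₜ[ℤ] w i))
    (hu : ∀ i, u i (w i) = 1) :
    (AddMonoidHom.pi fun i => evalAt (w i)).range.index = σ.multiplicity ∧ σ.multiplicity ≠ 0 := by
  let w' : ι → σ.spanLattice := fun i =>
    ⟨w i, (mem_spanLattice_iff hcone _).2 (Submodule.subset_span ⟨i, rfl⟩)⟩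
  have hw' : LinearIndependent ℤ w' := by
    have h1 := hw.restrict_scalars' ℤ
    exact .of_comp ((TensorProduct.mk ℤ ℝ N 1).comp σ.spanLattice.subtype.toIntLinearMap) h1
  obtain ⟨c⟩ := nonempty_basis_spanLattice hw hcone hw'
  obtain ⟨h1, h2⟩ := index_range_evalAt c hw'
  have h3 : (AddMonoidHom.pi fun i => evalAt (w i)).range =
      (AddMonoidHom.pi fun i => evalAt (w' i)).range := by
    ext y
    constructor
    · rintro ⟨f, rfl⟩
      exact ⟨f.comp σ.spanLattice.subtype.toIntLinearMap, rfl⟩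
    · rintro ⟨f, rfl⟩
      obtain ⟨g, hg⟩ := exists_dual_extend f
      exact ⟨g, funext fun i => hg (w' i)⟩
  have h4 : (AddSubgroup.closure (Set.range w')).index = σ.multiplicity := by
    rw [multiplicity, primitiveGenerators_eq_range hw hcone hu, AddSubgroup.relIndex,
      AddSubgroup.addSubgroupOf, show Set.range w = σ.spanLattice.subtype '' Set.range w' by
        rw [← Set.range_comp]; rfl, ← AddMonoidHom.map_closure,
      AddSubgroup.comap_map_eq_self_of_injective Subtype.val_injective]
  rw [h3, h1, ← h4]
  exact ⟨rfl, h1 ▸ h2⟩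

theorem isCutOutBy_dualMonoid
    (hw : LinearIndependent ℝ fun i => (1 : ℝ) ⊗ₜ[ℤ] w i)
    (hcone : σ.cone = PointedCone.hull ℝ (Set.range fun i => (1 : ℝ) ⊗ₜ[ℤ] w i))
    (hu : ∀ i, u i (w i) = 1) :
    IsCutOutBy σ.dualMonoid fun i => evalAt (w i) where
  mem_iff f := by
    classical
    rw [σ.mem_dualMonoid_iff (V := Finset.univ.image w) (by
      rw [hcone, Finset.coe_image, Finset.coe_univ, Set.image_univ, ← Set.range_comp]; rfl)]
    simp [evalAt_apply]
  exists_eq_one i := ⟨u i, hu i⟩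
  exists_pos i := by
    classical
    obtain ⟨h1, h2⟩ := index_range_evalAt_eq_multiplicity hw hcone hu
    -- The index is finite and nonzero, so this multiple of the vector with entry `0` at `i` and `1`
    -- elsewhere comes from an integral form.
    obtain ⟨f, hf⟩ := (AddMonoidHom.pi fun i => evalAt (w i)).range.nsmul_index_mem
      (fun j => if j = i then 0 else 1)
    rw [h1] at hf
    have hfj : ∀ j, f (w j) = σ.multiplicity • if j = i then 0 else 1 := congrFun hf
    refine ⟨f, ?_, fun j hj => ?_⟩
    · rw [evalAt_apply, hfj, if_pos rfl, smul_zero]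
    · rw [evalAt_apply, hfj, if_neg hj, nsmul_eq_mul, mul_one]
      exact Nat.cast_pos.2 (Nat.pos_of_ne_zero h2)

variable (σ) in
theorem natCard_localClassGroup_dualMonoid (k : Type u) [Field k] (hσ : σ.cone.IsSimplicial) :
    Finite (LocalClassGroup k σ.dualMonoid) ∧
      Nat.card (LocalClassGroup k σ.dualMonoid) = σ.multiplicity := by
  obtain ⟨ι, _, w, u, hw, hcone, hu⟩ := σ.exists_unimodular_generators hσ
  obtain ⟨h1, h2⟩ := index_range_evalAt_eq_multiplicity hw hcone hu
  have h3 := ((isCutOutBy_dualMonoid hw hcone hu).natCard_localClassGroup k).trans h1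
  exact ⟨Nat.finite_of_card_ne_zero (h3.trans_ne h2), h3⟩

end RationalCone

end Toric

theorem mainTheorem5 {k : Type u} [Field k] {N : Type v} [AddCommGroup N] [Module.Free ℤ N]
    [Module.Finite ℤ N] :
    -- the order in `G` of a torus-invariant Weil divisor on `X_Δ`
    (∀ (Δ : Toric.MonoidFan (Module.Dual ℤ N)) (D : Δ.ToricWeilDivisor k),
      IsOfFinAddOrder (Δ.toG D) →
        addOrderOf (Δ.toG D) = (Δ.chartsOn D).lcm fun S => addOrderOf (Δ.toCl S D)) ∧
    -- on a chart whose point lies on a prime divisor `D`, the restriction of `D` is a prime `p`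
    (∀ (Δ : Toric.MonoidFan (Module.Dual ℤ N)) (D : Δ.ToricPrimeDivisor k),
      ∀ S ∈ Δ.chartsOn (Finsupp.single D 1), ∃ p : Toric.AffinePrimeDivisor k S.1,
        Δ.ofChart S p = D ∧ Δ.restrict S (Finsupp.single D 1) = Finsupp.single p 1) ∧
    -- the order of the group of the affine toric variety of a simplicial cone
    (∀ σ : Toric.RationalCone N, σ.cone.IsSimplicial →
      Finite (Toric.LocalClassGroup k σ.dualMonoid) ∧
        Nat.card (Toric.LocalClassGroup k σ.dualMonoid) = σ.multiplicity) := by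
  exact ⟨fun Δ D _ => Δ.addOrderOf_toG D, fun Δ D S hS => Δ.exists_ofChart_eq D hS,
    fun σ hσ => σ.natCard_localClassGroup_dualMonoid k hσ⟩
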